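/- Let $G$ be a (discrete) group. A family of subgroups of $G$ is a non-empty set of subgroups closed under conjugation and under passing to subgroups. For a family $\mathcal F$ let $G/\mathcal F=\coprod_{H\in\mathcal F}G/H$ as a $G$-set, and for a subgroup $H\le G$ let $\mathcal F|_H=\{L\cap H : L\in\mathcal F\}$. A group $H$ is amenable relative to a set $\mathcal L$ of its subgroups if there is an $H$-invariant mean on $H/\mathcal L=\coprod_{L\in\mathcal L}H/L$, i.e. a linear map $m:\ell^\infty(H/\mathcal L)\to\mathbb R$ with $m(1)=1$, $m(f)\ge 0$ for $f\ge0$, and $m(h\cdot f)=m(f)$ for $h\in H$. A normed $\mathbb RG$-module is a real normed space $V$ with a linear isometric action of $G$; its dual $V^\#$ is the topological dual with the action $(g\cdot\varphi)(v)=\varphi(g^{-1}v)$. For a normed $\mathbb RG$-module $W$, the bounded Bredon cohomology $H^n_{\mathcal F,b}(G;W)$, $n\ge 0$, is the cohomology of the complex of bounded $G$-equivariant maps $f:(G/\mathcal F)^{n+1}\to W$ (equivalently, of $G$-equivariant linear maps $\mathbb R[(G/\mathcal F)^{n+1}]\to W$ that are bounded for the $\ell^1$-norm) with differential $$(\delta^n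 f)(x_0,\dots,x_{n+1})=\sum_{i=0}^{n+1}(-1)^i f(x_0,\dots,\widehat{x_i},\dots,x_{n+1}).$$ For families $\mathcal F\subset\mathcal G$, the canonical map $\mathrm{can}^n:H^n_{\mathcal G,b}(G;W)\to H^n_{\mathcal F,b}(G;W)$ is induced by restricting cochains along the inclusion of $G$-sets $G/\mathcal F\subset G/\mathcal G$. Finally, let $\ell^\infty(G/\mathcal F)/\mathbb R$ be the quotient of the normed $\mathbb RG$-module $\ell^\infty(G/\mathcal F)$ by the constant functions. The relative Johnson class $[J_{\mathcal F}]\in H^1_{\mathcal F,b}(G;(\ell^\infty(G/\mathcal F)/\mathbb R)^\#)$ is the class of the cocycle $J_{\mathcal F}(x_0,x_1)=\epsilon_{x_1}-\epsilon_{x_0}$, where $\epsilon_x$ denotes evaluation at $x$. **Theorem.** Let $G$ be a group and let $\mathcal F\subset\mathcal G$ be two families of subgroups of $G$. The following are equivalent: 1. every subgroup $H\in\mathcal G$ is amenable relative to $\mathcal F|_H$; 2. the canonical map $\mathrm{can}^n:H^n_{\mathcal G,b}(G;V^\#)\to H^n_{\mathcal F,b}(G;V^\#)$ is an isomorphism for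 every normed $\mathbb RG$-module $V$ and all $n\ge 0$; 3. the canonical map $\mathrm{can}^1:H^1_{\mathcal G,b}(G;V^\#)\to H^1_{\mathcal F,b}(G;V^\#)$ is an isomorphism for every normed $\mathbb RG$-module $V$; 4. the relative Johnson class $[J_{\mathcal F}]\in H^1_{\mathcal F,b}(G;(\ell^\infty(G/\mathcal F)/\mathbb R)^\#)$ lies in the image of the canonical map $\mathrm{can}^1:H^1_{\mathcal G,b}(G;(\ell^\infty(G/\mathcal F)/\mathbb R)^\#)\to H^1_{\mathcal F,b}(G;(\ell^\infty(G/\mathcal F)/\mathbb R)^\#)$. -/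

import Mathlib

open scoped ENNReal

universe u v w

noncomputable section

namespace BoundedBredon

/-! ### Families of subgroups -/

section Families

variable {G : Type u} [Group G]

/-- A family of subgroups: a non-empty set of subgroups closed under conjugation and under passing
to subgroups. -/
structure IsFamily (F : Set (Subgroup G)) : Prop where
  nonempty : F.Nonempty
  conj_mem : ∀ H ∈ F, ∀ g : G, H.map (MulAut.conj g).toMonoidHom ∈ F
  mem_of_le : ∀ H ∈ F, ∀ K : Subgroup G, K ≤ H → K ∈ F

/-- The restriction `{L ∩ H | L ∈ F}`, as a set of subgroups of the group `H`. -/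
def restrict (F : Set (Subgroup G)) (H : Subgroup G) : Set (Subgroup H) :=
  {K | ∃ L ∈ F, K = L.subgroupOf H}

/-- The `G`-set `G/F`, the disjoint union of all `G/H` with `H ∈ F`; the action of `G` is by left
translation on each summand. -/
abbrev Cosets (F : Set (Subgroup G)) : Type u := Σ H : F, G ⧸ (H : Subgroup G)

/-- For `F ⊆ E`, the inclusion of `G`-sets `G/F → G/E`. -/
def cosetsIncl {F E : Set (Subgroup G)} (h : F ⊆ E) : Cosets F →[G] Cosets E where
  toFun x := ⟨Set.inclusion h x.1, x.2⟩
  map_smul' _ _ := rfl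

end Families

/-! ### Normed modules -/

section NormedModules

variable {G : Type u} [Group G]

/-- The structure of a normed `ℝG`-module on a real normed space `V`: an action of `G` by linear
isometries. -/
abbrev NormedRep (G : Type u) [Group G] (V : Type v) [NormedAddCommGroup V] [NormedSpace ℝ V] :=
  G →* (V ≃ₗᵢ[ℝ] V)

variable {V : Type v} [NormedAddCommGroup V] [NormedSpace ℝ V]

/-- A linear action of `G` that does not increase norms is an action by linear isometries. -/
def NormedRep.ofLinear (f : G → V →ₗ[ℝ] V) (h_one : ∀ v, f 1 v = v)
    (h_mul : ∀ g h v, f (g * h) v = f g (f h v)) (h_le : ∀ g v, ‖f g v‖ ≤ ‖v‖) :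
    NormedRep G V where
  toFun g :=
    { toLinearEquiv := LinearEquiv.ofLinearMap (f g) (f g⁻¹)
        (by ext v; simp [← h_mul, h_one]) (by ext v; simp [← h_mul, h_one])
      norm_map' := fun v => by
        refine le_antisymm (h_le g v) ?_
        have h := h_le g⁻¹ (f g v)
        rwa [← h_mul, inv_mul_cancel, h_one] at h }
  map_one' := by ext v; exact h_one v
  map_mul' g h := by ext v; exact h_mul g h v

@[simp]
theorem NormedRep.ofLinear_apply (f : G → V →ₗ[ℝ] V) (h_one : ∀ v, f 1 v = v)
    (h_mul : ∀ g h v, f (g * h) v = f g (f h v)) (h_le : ∀ g v, ‖f g v‖ ≤ ‖v‖) (g : G) (v : V) :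
    NormedRep.ofLinear f h_one h_mul h_le g v = f g v := rfl

/-- The action `(g • φ)(v) = φ(g⁻¹ v)` on the topological dual of a normed `ℝG`-module. -/
def dualRep (ρ : NormedRep G V) : NormedRep G (StrongDual ℝ V) :=
  NormedRep.ofLinear
    (fun g =>
      { toFun := fun φ => φ.comp (ρ g⁻¹).toContinuousLinearEquiv.toContinuousLinearMap
        map_add' := fun _ _ => rfl
        map_smul' := fun _ _ => rfl })
    (fun φ => by ext v; simp)
    (fun g h φ => by ext v; simp)
    (fun g φ => ContinuousLinearMap.opNorm_le_bound _ (norm_nonneg _) fun v => by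
      exact (φ.le_opNorm (ρ g⁻¹ v)).trans_eq (by rw [(ρ g⁻¹).norm_map]))

theorem dualRep_apply (ρ : NormedRep G V) (g : G) (φ : StrongDual ℝ V) (v : V) :
    dualRep ρ g φ v = φ (ρ g⁻¹ v) := rfl

end NormedModules

/-! ### Bounded functions on a `G`-set and invariant means -/

section BoundedFunctions

variable {G : Type u} [Group G]

/-- The Banach space of bounded real functions on `S`, with the supremum norm. -/
abbrev LInf (S : Type v) : Type v := lp (fun _ : S => ℝ) ∞

variable {S : Type v} [MulAction G S]

/-- The action `(g • f)(s) = f(g⁻¹ s)` on bounded functions. -/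
def lInfRep (G : Type u) [Group G] (S : Type v) [MulAction G S] : NormedRep G (LInf S) :=
  NormedRep.ofLinear
    (fun g =>
      { toFun := fun f => ⟨fun s => f (g⁻¹ • s), memℓp_infty <| by
          obtain ⟨C, hC⟩ := memℓp_infty_iff.1 (lp.memℓp f)
          exact ⟨C, by rintro _ ⟨s, rfl⟩; exact hC ⟨g⁻¹ • s, rfl⟩⟩⟩
        map_add' := fun _ _ => rfl
        map_smul' := fun _ _ => rfl })
    (fun f => by ext s; simp)
    (fun g h f => by
      ext s
      change f ((g * h)⁻¹ • s) = f (h⁻¹ • g⁻¹ • s)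
      rw [mul_inv_rev, mul_smul])
    (fun g f => lp.norm_le_of_forall_le (norm_nonneg _) fun s =>
      lp.norm_apply_le_norm ENNReal.top_ne_zero f (g⁻¹ • s))

theorem lInfRep_apply (g : G) (f : LInf S) (s : S) : lInfRep G S g f s = f (g⁻¹ • s) := rfl

/-- The `G`-set `S` admits a `G`-invariant mean: a normalized, non-negative, `G`-invariant linear
functional on the bounded functions on `S`. -/
def HasInvariantMean (G : Type u) [Group G] (S : Type v) [MulAction G S] : Prop :=
  ∃ m : LInf S →ₗ[ℝ] ℝ, m 1 = 1 ∧ (∀ f : LInf S, (∀ s, 0 ≤ f s) → 0 ≤ m f) ∧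
    ∀ (g : G) (f : LInf S), m (lInfRep G S g f) = m f

/-- `G` is amenable relative to the set of subgroups `F`. -/
def AmenableRelativeTo (G : Type u) [Group G] (F : Set (Subgroup G)) : Prop :=
  HasInvariantMean G (Cosets F)

/-- The subspace of constant functions. -/
def constants (S : Type v) : Submodule ℝ (LInf S) := Submodule.span ℝ {1}

instance constants_isClosed : IsClosed (constants S : Set (LInf S)) := by
  have : FiniteDimensional ℝ (constants S) := by unfold constants; infer_instance
  exact (constants S).closed_of_finiteDimensional

theorem lInfRep_one (g : G) : lInfRep G S g (1 : LInf S) = 1 := by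
  ext s; simp [lInfRep_apply]

theorem constants_le_comap (g : G) :
    constants S ≤ (constants S).comap (lInfRep G S g).toLinearEquiv.toLinearMap := by
  refine Submodule.span_le.2 ?_
  rintro _ rfl
  change lInfRep G S g (1 : LInf S) ∈ constants S
  rw [lInfRep_one]
  exact Submodule.mem_span_singleton_self _

/-- The normed space of bounded functions modulo constants, with the quotient norm. -/
def LInfModConst (S : Type v) : Type v := LInf S ⧸ constants S

instance (S : Type v) : NormedAddCommGroup (LInfModConst S) :=
  inferInstanceAs (NormedAddCommGroup (LInf S ⧸ constants S))

instance (S : Type v) : NormedSpace ℝ (LInfModConst S) :=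
  inferInstanceAs (NormedSpace ℝ (LInf S ⧸ constants S))

/-- The quotient map. -/
def LInfModConst.mk {S : Type v} : LInf S →ₗ[ℝ] LInfModConst S := (constants S).mkQ

theorem LInfModConst.mk_surjective {S : Type v} :
    Function.Surjective (LInfModConst.mk : LInf S →ₗ[ℝ] LInfModConst S) :=
  Submodule.mkQ_surjective _

theorem LInfModConst.mk_one {S : Type v} : LInfModConst.mk (1 : LInf S) = 0 :=
  (Submodule.Quotient.mk_eq_zero _).2 (Submodule.mem_span_singleton_self _)

/-- The action of `G` on bounded functions modulo constants. -/
def lInfModConstRep (G : Type u) [Group G] (S : Type v) [MulAction G S] :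
    NormedRep G (LInfModConst S) :=
  NormedRep.ofLinear
    (fun g => (constants S).mapQ (constants S) (lInfRep G S g).toLinearEquiv.toLinearMap
      (constants_le_comap g))
    (fun x => by
      obtain ⟨f, rfl⟩ := Submodule.Quotient.mk_surjective _ x
      change (constants S).mkQ (lInfRep G S 1 f) = (constants S).mkQ f
      rw [map_one]
      rfl)
    (fun g h x => by
      obtain ⟨f, rfl⟩ := Submodule.Quotient.mk_surjective _ x
      change (constants S).mkQ (lInfRep G S (g * h) f) =
        (constants S).mkQ (lInfRep G S g (lInfRep G S h f))
      rw [map_mul]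
      rfl)
    (fun g x => by
      refine le_of_forall_pos_lt_add fun ε hε => ?_
      obtain ⟨f, rfl, hf⟩ := Submodule.Quotient.norm_mk_lt x hε
      refine lt_of_le_of_lt ?_ hf
      exact (Submodule.Quotient.norm_mk_le _ _).trans ((lInfRep G S g).norm_map f).le)

theorem lInfModConstRep_mk (g : G) (f : LInf S) :
    lInfModConstRep G S g (LInfModConst.mk f) = LInfModConst.mk (lInfRep G S g f) :=
  rfl

end BoundedFunctions

/-! ### The bounded cochain complex of a `G`-set -/

section Cohomology

variable {G : Type u} [Group G] {V : Type v} [NormedAddCommGroup V] [NormedSpace ℝ V]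

/-- A linear map on the free module on `S` is bounded for the `ℓ¹`-norm if and only if it is
bounded on the basis. -/
theorem bounded_linear_iff {S : Type w} (φ : (S →₀ ℝ) →ₗ[ℝ] V) :
    (∃ C : ℝ, ∀ c : S →₀ ℝ, ‖φ c‖ ≤ C * c.sum fun _ r => |r|) ↔
      ∃ C : ℝ, ∀ s, ‖φ (Finsupp.single s 1)‖ ≤ C := by
  refine ⟨fun ⟨C, hC⟩ => ⟨C, fun s => by simpa using hC (Finsupp.single s 1)⟩,
    fun ⟨C, hC⟩ => ⟨C, fun c => ?_⟩⟩
  have h : φ c = ∑ s ∈ c.support, c s • φ (Finsupp.single s 1) := by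
    conv_lhs => rw [← c.sum_single]
    rw [Finsupp.sum, map_sum]
    refine Finset.sum_congr rfl fun s _ => ?_
    rw [← map_smul, Finsupp.smul_single, smul_eq_mul, mul_one]
  rw [h, Finsupp.sum, Finset.mul_sum]
  refine (norm_sum_le _ _).trans (Finset.sum_le_sum fun s _ => ?_)
  rw [norm_smul, Real.norm_eq_abs, mul_comm]
  exact mul_le_mul_of_nonneg_right (hC s) (abs_nonneg _)

/-- The `G`-invariant bounded `n`-cochains on the `G`-set `X` with values in `V`. An `ℝ`-linear
map on the free module on `X^{n+1}` which is bounded for the `ℓ¹`-norm is the same as a bounded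
function on the basis `X^{n+1}`, and it is invariant for `(g • f)(x) = g • f(g⁻¹ • x)` if and only
if this function is equivariant. -/
def cochains (ρ : NormedRep G V) (X : Type w) [MulAction G X] (n : ℕ) :
    Submodule ℝ ((Fin (n + 1) → X) → V) where
  carrier := {f | (∃ C : ℝ, ∀ x, ‖f x‖ ≤ C) ∧ ∀ (g : G) x, f (g • x) = ρ g (f x)}
  zero_mem' := ⟨⟨0, by simp⟩, by simp⟩
  add_mem' := by
    rintro f f' ⟨⟨C, hC⟩, hf⟩ ⟨⟨C', hC'⟩, hf'⟩
    exact ⟨⟨C + C', fun x => (norm_add_le _ _).trans (add_le_add (hC x) (hC' x))⟩,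
      fun g x => by simp [hf, hf']⟩
  smul_mem' := by
    rintro c f ⟨⟨C, hC⟩, hf⟩
    exact ⟨⟨‖c‖ * C, fun x => by
      rw [Pi.smul_apply, norm_smul]
      exact mul_le_mul_of_nonneg_left (hC x) (norm_nonneg c)⟩, fun g x => by simp [hf]⟩

/-- The differential `(δ f)(x₀, …, x_{n+1}) = ∑ᵢ (-1)ⁱ f(x₀, …, x̂ᵢ, …, x_{n+1})`. -/
def differential (V : Type v) [NormedAddCommGroup V] [NormedSpace ℝ V] (X : Type w) (n : ℕ) :
    ((Fin (n + 1) → X) → V) →ₗ[ℝ] ((Fin (n + 2) → X) → V) where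
  toFun f x := ∑ i : Fin (n + 2), (-1 : ℝ) ^ (i : ℕ) • f (fun j => x (i.succAbove j))
  map_add' f f' := by
    ext x
    simp [Finset.sum_add_distrib]
  map_smul' c f := by
    ext x
    simp [Finset.smul_sum, smul_comm c]

theorem differential_mem_cochains (ρ : NormedRep G V) (X : Type w) [MulAction G X] (n : ℕ)
    (f : (Fin (n + 1) → X) → V) (h : f ∈ cochains ρ X n) :
    differential V X n f ∈ cochains ρ X (n + 1) := by
  obtain ⟨⟨C, hC⟩, hf⟩ := h
  refine ⟨⟨∑ _i : Fin (n + 2), C, fun x => ?_⟩, fun g x => ?_⟩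
  · change ‖∑ i : Fin (n + 2), (-1 : ℝ) ^ (i : ℕ) • f (fun j => x (i.succAbove j))‖ ≤ _
    refine (norm_sum_le _ _).trans (Finset.sum_le_sum fun i _ => ?_)
    simpa [norm_smul] using hC _
  · change ∑ i : Fin (n + 2), (-1 : ℝ) ^ (i : ℕ) • f (fun j => (g • x) (i.succAbove j)) =
      ρ g (∑ i : Fin (n + 2), (-1 : ℝ) ^ (i : ℕ) • f (fun j => x (i.succAbove j)))
    rw [map_sum]
    refine Finset.sum_congr rfl fun i _ => ?_
    rw [map_smul]
    exact congrArg _ (hf g fun j => x (i.succAbove j))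

theorem differential_differential (X : Type w) (n : ℕ) (f : (Fin (n + 1) → X) → V) :
    differential V X (n + 1) (differential V X n f) = 0 := by
  funext x
  change ∑ i : Fin (n + 3), (-1 : ℝ) ^ (i : ℕ) • ∑ j : Fin (n + 2), (-1 : ℝ) ^ (j : ℕ) •
    f (fun k => x (i.succAbove (j.succAbove k))) = 0
  simp only [Finset.smul_sum, smul_smul, ← pow_add]
  rw [← Finset.sum_product', Finset.univ_product_univ]
  refine Finset.sum_involution (fun p _ => (p.1.succAbove p.2, p.2.predAbove p.1))
    (fun p _ => ?_) (fun p _ _ h => ?_) (fun _ _ => Finset.mem_univ _) (fun p _ => ?_)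
  · dsimp only
    simp only [Fin.succAbove_succAbove_succAbove_predAbove, Fin.neg_one_pow_succAbove_add_predAbove,
      neg_smul, add_neg_cancel]
  · exact Fin.succAbove_ne p.1 p.2 (congrArg Prod.fst h)
  · have h := Fin.succAbove_succAbove_predAbove p.1 p.2
    have h' := Fin.succAbove_succAbove_predAbove (p.1.succAbove p.2) (p.2.predAbove p.1)
    rw [h] at h'
    exact Prod.ext h (Fin.succAbove_right_injective (p := p.1) h')

/-- The `n`-cocycles: the invariant bounded cochains that the differential sends to zero. -/
def cocycles (ρ : NormedRep G V) (X : Type w) [MulAction G X] (n : ℕ) :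
    Submodule ℝ ((Fin (n + 1) → X) → V) :=
  cochains ρ X n ⊓ LinearMap.ker (differential V X n)

/-- The `n`-coboundaries: the image under the differential of the invariant bounded
`(n - 1)`-cochains. -/
def coboundaries (ρ : NormedRep G V) (X : Type w) [MulAction G X] :
    (n : ℕ) → Submodule ℝ ((Fin (n + 1) → X) → V)
  | 0 => ⊥
  | n + 1 => (cochains ρ X n).map (differential V X n)

theorem coboundaries_le_cocycles (ρ : NormedRep G V) (X : Type w) [MulAction G X] :
    ∀ n : ℕ, coboundaries ρ X n ≤ cocycles ρ X n
  | 0 => bot_le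
  | n + 1 => by
    rintro _ ⟨f, hf, rfl⟩
    exact ⟨differential_mem_cochains ρ X n f hf, differential_differential X n f⟩

/-- The `n`-th cohomology, cocycles modulo coboundaries, of the complex of `G`-invariant bounded
cochains on the `G`-set `X`. -/
def cohomology (ρ : NormedRep G V) (X : Type w) [MulAction G X] (n : ℕ) : Type (max v w) :=
  cocycles ρ X n ⧸ (coboundaries ρ X n).submoduleOf (cocycles ρ X n)

instance (ρ : NormedRep G V) (X : Type w) [MulAction G X] (n : ℕ) :
    AddCommGroup (cohomology ρ X n) :=
  inferInstanceAs
    (AddCommGroup (cocycles ρ X n ⧸ (coboundaries ρ X n).submoduleOf (cocycles ρ X n)))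

instance (ρ : NormedRep G V) (X : Type w) [MulAction G X] (n : ℕ) :
    Module ℝ (cohomology ρ X n) :=
  inferInstanceAs
    (Module ℝ (cocycles ρ X n ⧸ (coboundaries ρ X n).submoduleOf (cocycles ρ X n)))

/-- The cohomology class of a cocycle. -/
def cohomologyClass (ρ : NormedRep G V) (X : Type w) [MulAction G X] (n : ℕ) :
    cocycles ρ X n →ₗ[ℝ] cohomology ρ X n :=
  ((coboundaries ρ X n).submoduleOf (cocycles ρ X n)).mkQ

theorem cohomologyClass_surjective (ρ : NormedRep G V) (X : Type w) [MulAction G X] (n : ℕ) :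
    Function.Surjective (cohomologyClass ρ X n) :=
  Submodule.mkQ_surjective _

theorem cohomologyClass_eq_iff (ρ : NormedRep G V) (X : Type w) [MulAction G X] (n : ℕ)
    (c d : cocycles ρ X n) :
    cohomologyClass ρ X n c = cohomologyClass ρ X n d ↔
      (c : (Fin (n + 1) → X) → V) - d ∈ coboundaries ρ X n :=
  Submodule.Quotient.eq _

variable {X : Type w} {Y : Type w} [MulAction G X] [MulAction G Y]

/-- Pulling back functions along a `G`-map. -/
def pullback (V : Type v) [NormedAddCommGroup V] [NormedSpace ℝ V] (p : X →[G] Y) (n : ℕ) :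
    ((Fin (n + 1) → Y) → V) →ₗ[ℝ] ((Fin (n + 1) → X) → V) where
  toFun f x := f (fun i => p (x i))
  map_add' _ _ := rfl
  map_smul' _ _ := rfl

theorem differential_pullback (p : X →[G] Y) (n : ℕ) (f : (Fin (n + 1) → Y) → V) :
    differential V X n (pullback V p n f) = pullback V p (n + 1) (differential V Y n f) := rfl

theorem pullback_mem_cochains (ρ : NormedRep G V) (p : X →[G] Y) (n : ℕ)
    (f : (Fin (n + 1) → Y) → V) (h : f ∈ cochains ρ Y n) :
    pullback V p n f ∈ cochains ρ X n := by
  obtain ⟨⟨C, hC⟩, hf⟩ := h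
  refine ⟨⟨C, fun x => hC _⟩, fun g x => ?_⟩
  have h : (fun i => p ((g • x) i)) = g • fun i => p (x i) := by
    funext i; simp
  change f (fun i => p ((g • x) i)) = _
  rw [h, hf]
  rfl

theorem pullback_mem_cocycles (ρ : NormedRep G V) (p : X →[G] Y) (n : ℕ)
    (f : (Fin (n + 1) → Y) → V) (h : f ∈ cocycles ρ Y n) :
    pullback V p n f ∈ cocycles ρ X n := by
  refine ⟨pullback_mem_cochains ρ p n f h.1, ?_⟩
  have hf : differential V Y n f = 0 := h.2
  change differential V X n (pullback V p n f) = 0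
  rw [differential_pullback, hf, map_zero]

theorem pullback_mem_coboundaries (ρ : NormedRep G V) (p : X →[G] Y) :
    ∀ (n : ℕ) (f : (Fin (n + 1) → Y) → V), f ∈ coboundaries ρ Y n →
      pullback V p n f ∈ coboundaries ρ X n
  | 0, f, hf => by
    have hf' : f = 0 := hf
    rw [hf', map_zero]
    exact Submodule.zero_mem _
  | n + 1, f, hf => by
    obtain ⟨b, hb, rfl⟩ := hf
    exact ⟨pullback V p n b, pullback_mem_cochains ρ p n b hb, differential_pullback p n b⟩

/-- The map induced on cohomology by a `G`-map. -/
def cohomologyMap (ρ : NormedRep G V) (p : X →[G] Y) (n : ℕ) :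
    cohomology ρ Y n →ₗ[ℝ] cohomology ρ X n :=
  Submodule.mapQ ((coboundaries ρ Y n).submoduleOf (cocycles ρ Y n))
    ((coboundaries ρ X n).submoduleOf (cocycles ρ X n))
    ((pullback V p n).restrict (pullback_mem_cocycles ρ p n)) fun f hf =>
    pullback_mem_coboundaries ρ p n f.1 hf

end Cohomology

/-! ### Bounded Bredon cohomology -/

section BoundedBredonCohomology

variable {G : Type u} [Group G] {V : Type v} [NormedAddCommGroup V] [NormedSpace ℝ V]

/-- The bounded Bredon cohomology of `G` relative to `F` with coefficients in the normed
`ℝG`-module `(V, ρ)`. -/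
abbrev bredonCohomology (F : Set (Subgroup G)) (ρ : NormedRep G V) (n : ℕ) :=
  cohomology ρ (Cosets F) n

/-- The canonical map, for `F ⊆ E`, from the bounded Bredon cohomology relative to `E` to that
relative to `F`. -/
def canonicalMap {F E : Set (Subgroup G)} (h : F ⊆ E) (ρ : NormedRep G V) (n : ℕ) :
    bredonCohomology E ρ n →ₗ[ℝ] bredonCohomology F ρ n :=
  cohomologyMap ρ (cosetsIncl h) n

/-- Evaluation of bounded functions at a point, as an element of the dual. -/
def evalAt {S : Type v} (s : S) : StrongDual ℝ (LInf S) :=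
  LinearMap.mkContinuous
    { toFun := fun f : LInf S => f s
      map_add' := fun _ _ => rfl
      map_smul' := fun _ _ => rfl } 1
    fun f => (lp.norm_apply_le_norm ENNReal.top_ne_zero f s).trans_eq (one_mul _).symm

theorem evalAt_apply {S : Type v} (s : S) (f : LInf S) : evalAt s f = f s := rfl

theorem constants_le_ker {S : Type v} (s t : S) :
    constants S ≤ (evalAt t - evalAt s : StrongDual ℝ (LInf S)).ker := by
  refine Submodule.span_le.2 ?_
  rintro _ rfl
  simp [evalAt_apply]

/-- The difference of evaluations `ε_t - ε_s`, as a functional on bounded functions modulo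
constants. -/
def evalDiff {S : Type v} (s t : S) : StrongDual ℝ (LInfModConst S) :=
  (constants S).liftQL (evalAt t - evalAt s) (constants_le_ker s t)

theorem evalDiff_mk {S : Type v} (s t : S) (f : LInf S) :
    evalDiff s t (LInfModConst.mk f) = f t - f s := rfl

theorem norm_evalDiff_le {S : Type v} (s t : S) : ‖evalDiff s t‖ ≤ 2 := by
  refine ContinuousLinearMap.opNorm_le_bound _ zero_le_two fun x => ?_
  refine le_of_forall_pos_le_add fun ε hε => ?_
  obtain ⟨f, rfl, hf⟩ := Submodule.Quotient.norm_mk_lt x (half_pos hε)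
  change ‖f t - f s‖ ≤ 2 * ‖(Submodule.Quotient.mk f : LInf S ⧸ constants S)‖ + ε
  have h1 := lp.norm_apply_le_norm ENNReal.top_ne_zero f t
  have h2 := lp.norm_apply_le_norm ENNReal.top_ne_zero f s
  have h3 := norm_sub_le (f t) (f s)
  linarith

/-- The coefficient module of the relative Johnson class: the dual of the bounded functions on
`G/F` modulo constants. -/
abbrev johnsonRep (F : Set (Subgroup G)) : NormedRep G (StrongDual ℝ (LInfModConst (Cosets F))) :=
  dualRep (lInfModConstRep G (Cosets F))

/-- The relative Johnson cocycle `J(x₀, x₁) = ε_{x₁} - ε_{x₀}`. -/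
def johnsonCocycle (F : Set (Subgroup G)) :
    (Fin 2 → Cosets F) → StrongDual ℝ (LInfModConst (Cosets F)) :=
  fun x => evalDiff (x 0) (x 1)

theorem johnsonCocycle_mem_cocycles (F : Set (Subgroup G)) :
    johnsonCocycle F ∈ cocycles (johnsonRep F) (Cosets F) 1 := by
  refine ⟨⟨⟨2, fun x => norm_evalDiff_le _ _⟩, fun g x => ?_⟩,
    LinearMap.mem_ker.2 (funext fun x => ?_)⟩
  · ext y
    obtain ⟨f, rfl⟩ := LInfModConst.mk_surjective y
    rw [dualRep_apply, lInfModConstRep_mk, johnsonCocycle, evalDiff_mk, johnsonCocycle,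
      evalDiff_mk, lInfRep_apply, lInfRep_apply, inv_inv]
    rfl
  · ext y
    obtain ⟨f, rfl⟩ := LInfModConst.mk_surjective y
    simp [differential, johnsonCocycle, Fin.sum_univ_three, evalDiff_mk, Fin.succAbove, Fin.lt_def]

/-- The relative Johnson class. -/
def johnsonClass (F : Set (Subgroup G)) : bredonCohomology F (johnsonRep F) 1 :=
  cohomologyClass _ _ _ ⟨johnsonCocycle F, johnsonCocycle_mem_cocycles F⟩

end BoundedBredonCohomology

end BoundedBredon

end

noncomputable section

namespace BoundedBredon

/-! ### The real cochain complex and iterated means -/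

section IteratedMeans

variable {X : Type*} {Y : Type*} {Z : Type*}

/-! Condition 1 amounts to giving every point y of G/E a mean μ_y on G/F with μ_{gy} = gμ_y. Point
stabilizers in G/E belong to E, so a mean invariant under the stabilizer of one point per orbit can
be spread over that orbit (`exists_isMeanKernel`).

Such a kernel gives 1 → 2 by integration: a cochain on G/F becomes a cochain on G/E when its
variables are integrated one after another against μ_{y_0}, …, μ_{y_n}. Dual coefficients allow this
to be done after evaluation at a vector, which reduces everything to real functions. Integration is
a chain map because means have mass one, and any two kernels induce homotopic maps
(`realDifferential_meanHomotopy`). Both composites of integration and restriction are again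
integrations against kernels, hence homotopic to integration against Dirac functionals, which is the
identity (`IsMeanKernel.bijective_cohomologyMap`). The variables are always integrated in the same
order, so no Fubini property of means is needed.

For 4 → 1, let c be a cocycle on G/E whose restriction to G/F is J + δb. If H ∈ E, the base coset
y_0 of G/H is fixed by H, and the functional f ↦ f(x) - c(y_0, x)(f) + b(x)(f) does not depend on x.
It is therefore bounded and H-invariant, with value 1 on the constant 1. It need not be positive,
but its positive part, rescaled, is an invariant mean (`hasInvariantMean_of_functional`). -/

/-- The differential on real functions, indexed by the number of variables. -/
def realDifferential (X : Type*) (n : ℕ) : ((Fin n → X) → ℝ) →ₗ[ℝ] ((Fin (n + 1) → X) → ℝ) where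
  toFun f x := ∑ i : Fin (n + 1), (-1 : ℝ) ^ (i : ℕ) • f (fun j => x (i.succAbove j))
  map_add' f f' := by
    ext x
    simp [Finset.sum_add_distrib, mul_add]
  map_smul' c f := by
    ext x
    simp [Finset.mul_sum, mul_left_comm c]

/-- The function of the remaining variables obtained by fixing the first variable. -/
def fixFirst (n : ℕ) (x : X) : ((Fin (n + 1) → X) → ℝ) →ₗ[ℝ] ((Fin n → X) → ℝ) where
  toFun f xs := f (Fin.cons x xs)
  map_add' _ _ := rfl
  map_smul' _ _ := rfl

theorem fixFirst_apply (n : ℕ) (x : X) (f : (Fin (n + 1) → X) → ℝ) (xs : Fin n → X) :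
    fixFirst n x f xs = f (Fin.cons x xs) := rfl

/-- Counting variables instead of degrees puts the augmentation by constants at index 0, where the
inductions below start. -/
theorem realDifferential_zero (f : (Fin 0 → X) → ℝ) (x : Fin 1 → X) :
    realDifferential X 0 f x = f Fin.elim0 := by
  change ∑ i : Fin 1, (-1 : ℝ) ^ (i : ℕ) • f (fun j => x (i.succAbove j)) = _
  rw [Fin.sum_univ_one, Fin.val_zero, pow_zero, one_smul]
  exact congrArg f (Subsingleton.elim _ _)

/-- The face omitting `x` gives the first term; every other face keeps `x` in front, and the index
shift flips its sign. All the inductions on the number of variables rest on this recursion. -/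
theorem realDifferential_cons (n : ℕ) (f : (Fin (n + 1) → X) → ℝ) (x : X) (xs : Fin (n + 1) → X) :
    realDifferential X (n + 1) f (Fin.cons x xs) =
      f xs - realDifferential X n (fixFirst n x f) xs := by
  simp only [realDifferential, LinearMap.coe_mk, AddHom.coe_mk, fixFirst_apply]
  rw [Fin.sum_univ_succ]
  simp only [Fin.val_zero, pow_zero, one_smul, Fin.zero_succAbove, Fin.cons_succ, Fin.val_succ,
    pow_succ, mul_neg, mul_one, neg_smul, Finset.sum_neg_distrib, ← sub_eq_add_neg]
  congr 1
  refine Finset.sum_congr rfl fun i _ => ?_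
  congr 2
  funext j
  refine Fin.cases ?_ (fun j => ?_) j
  · simp
  · simp

/-- Inserting a fixed point is the usual contracting homotopy of the augmented complex. -/
theorem fixFirst_realDifferential (n : ℕ) (f : (Fin (n + 1) → X) → ℝ) (x : X) :
    fixFirst (n + 1) x (realDifferential X (n + 1) f) =
      f - realDifferential X n (fixFirst n x f) :=
  funext fun xs => realDifferential_cons n f x xs

/-- Apply a functional to each member of a family of functions. -/
theorem realDifferential_functional (n : ℕ) (m : (X → ℝ) →ₗ[ℝ] ℝ) (f : X → (Fin n → Y) → ℝ)
    (y : Fin (n + 1) → Y) :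
    realDifferential Y n (fun ys => m fun x => f x ys) y =
      m fun x => realDifferential Y n (f x) y := by
  have h : (fun x => realDifferential Y n (f x) y) =
      ∑ i : Fin (n + 1), (-1 : ℝ) ^ (i : ℕ) • fun x => f x (fun j => y (i.succAbove j)) := by
    funext x
    simp [realDifferential]
  rw [h, map_sum]
  simp only [map_smul]
  rfl

/-- The iterated application of a family of functionals on the functions on `X`, indexed by `Y`,
to all variables of a function. -/
def iteratedMean (μ : Y → (X → ℝ) →ₗ[ℝ] ℝ) :
    (n : ℕ) → ((Fin n → X) → ℝ) →ₗ[ℝ] ((Fin n → Y) → ℝ)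
  | 0 =>
    { toFun := fun f _ => f Fin.elim0
      map_add' := fun _ _ => rfl
      map_smul' := fun _ _ => rfl }
  | n + 1 =>
    { toFun := fun f y => μ (y 0) fun x => iteratedMean μ n (fixFirst n x f) (Fin.tail y)
      map_add' := fun f f' => by
        funext y
        simp only [map_add, Pi.add_apply]
        exact map_add (μ (y 0)) _ _
      map_smul' := fun c f => by
        funext y
        simp only [map_smul, Pi.smul_apply]
        exact map_smul (μ (y 0)) c _ }

theorem iteratedMean_zero (μ : Y → (X → ℝ) →ₗ[ℝ] ℝ) (f : (Fin 0 → X) → ℝ) (y : Fin 0 → Y) :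
    iteratedMean μ 0 f y = f Fin.elim0 := rfl

theorem iteratedMean_succ (μ : Y → (X → ℝ) →ₗ[ℝ] ℝ) (n : ℕ) (f : (Fin (n + 1) → X) → ℝ)
    (y : Fin (n + 1) → Y) :
    iteratedMean μ (n + 1) f y =
      μ (y 0) fun x => iteratedMean μ n (fixFirst n x f) (Fin.tail y) := rfl

theorem functional_const {m : (X → ℝ) →ₗ[ℝ] ℝ} (hm : m 1 = 1) (c : ℝ) : (m fun _ => c) = c := by
  have h : (fun _ : X => c) = c • (1 : X → ℝ) := by
    funext x
    simp
  rw [h, map_smul, hm, smul_eq_mul, mul_one]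

theorem functional_sub (m : (X → ℝ) →ₗ[ℝ] ℝ) (f g : X → ℝ) :
    (m fun x => f x - g x) = m f - m g := map_sub m f g

/-- Iterated means are compatible with the differential. -/
theorem realDifferential_iteratedMean {μ : Y → (X → ℝ) →ₗ[ℝ] ℝ} (hμ : ∀ y, μ y 1 = 1) :
    ∀ (n : ℕ) (f : (Fin n → X) → ℝ),
      realDifferential Y n (iteratedMean μ n f) = iteratedMean μ (n + 1) (realDifferential X n f)
  | 0, f => by
    funext y
    rw [realDifferential_zero, iteratedMean_succ]
    simp only [iteratedMean_zero, fixFirst_apply, realDifferential_zero]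
    rw [functional_const (hμ _)]
  | n + 1, f => by
    funext y
    rw [iteratedMean_succ]
    simp only [fixFirst_realDifferential, map_sub, Pi.sub_apply]
    rw [functional_sub, functional_const (hμ _)]
    conv_lhs => rw [← Fin.cons_self_tail y, realDifferential_cons]
    congr 1
    -- The induction hypothesis applies to each slice with first variable `x`; the outer functional
    -- then passes through the differential by linearity.
    simp only [← realDifferential_iteratedMean hμ n]
    rw [← realDifferential_functional]
    rfl

/-- The homotopy between the iterated means of two families of functionals. -/
def meanHomotopy (μ ν : Y → (X → ℝ) →ₗ[ℝ] ℝ) :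
    (n : ℕ) → ((Fin (n + 1) → X) → ℝ) →ₗ[ℝ] ((Fin n → Y) → ℝ)
  | 0 => 0
  | n + 1 =>
    { toFun := fun f y => μ (y 0) fun x => iteratedMean ν (n + 1) (fixFirst (n + 1) x f) y -
        meanHomotopy μ ν n (fixFirst (n + 1) x f) (Fin.tail y)
      map_add' := fun f f' => by
        funext y
        simp only [map_add, Pi.add_apply, add_sub_add_comm]
        exact map_add (μ (y 0)) _ _
      map_smul' := fun c f => by
        funext y
        simp only [map_smul, Pi.smul_apply, ← smul_sub]
        exact map_smul (μ (y 0)) c _ }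

theorem meanHomotopy_succ (μ ν : Y → (X → ℝ) →ₗ[ℝ] ℝ) (n : ℕ) (f : (Fin (n + 2) → X) → ℝ)
    (y : Fin (n + 1) → Y) :
    meanHomotopy μ ν (n + 1) f y =
      μ (y 0) fun x => iteratedMean ν (n + 1) (fixFirst (n + 1) x f) y -
        meanHomotopy μ ν n (fixFirst (n + 1) x f) (Fin.tail y) := rfl

/-- Unrolled, the homotopy is the prism operator: the alternating sum over i of f integrated against
μ_{y_0}, …, μ_{y_i}, ν_{y_i}, …, ν_{y_n}. The induction peels off the outermost integration, so only
linearity and mass one enter. -/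
theorem realDifferential_meanHomotopy {μ ν : Y → (X → ℝ) →ₗ[ℝ] ℝ} (hμ : ∀ y, μ y 1 = 1)
    (hν : ∀ y, ν y 1 = 1) :
    ∀ (n : ℕ) (f : (Fin (n + 1) → X) → ℝ) (y : Fin (n + 1) → Y),
      realDifferential Y n (meanHomotopy μ ν n f) y +
          meanHomotopy μ ν (n + 1) (realDifferential X (n + 1) f) y =
        iteratedMean ν (n + 1) f y - iteratedMean μ (n + 1) f y
  | 0, f, y => by
    have h0 : meanHomotopy μ ν 0 = 0 := rfl
    rw [meanHomotopy_succ, iteratedMean_succ μ]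
    simp only [h0, LinearMap.zero_apply, map_zero, Pi.zero_apply, zero_add, sub_zero,
      fixFirst_realDifferential, map_sub, Pi.sub_apply]
    rw [functional_sub, functional_const (hμ _)]
    congr 2
    funext x
    rw [← realDifferential_iteratedMean hν, realDifferential_zero]
    rfl
  | n + 1, f, y => by
    rw [meanHomotopy_succ]
    simp only [fixFirst_realDifferential, map_sub, Pi.sub_apply]
    simp only [functional_sub, functional_const (hμ _)]
    conv_lhs =>
      enter [1]
      rw [← Fin.cons_self_tail y, realDifferential_cons]
    have h1 : fixFirst n (y 0) (meanHomotopy μ ν (n + 1) f) = fun ys =>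
        μ (y 0) fun x => iteratedMean ν (n + 1) (fixFirst (n + 1) x f) (Fin.cons (y 0) ys) -
          meanHomotopy μ ν n (fixFirst (n + 1) x f) ys := rfl
    have h2 : ∀ x, iteratedMean ν (n + 2) (realDifferential X (n + 1) (fixFirst (n + 1) x f)) y =
        iteratedMean ν (n + 1) (fixFirst (n + 1) x f) (Fin.tail y) -
          realDifferential Y n
            (fixFirst n (y 0) (iteratedMean ν (n + 1) (fixFirst (n + 1) x f))) (Fin.tail y) := by
      intro x
      rw [← realDifferential_iteratedMean hν, ← realDifferential_cons, Fin.cons_self_tail]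
    have h3 : ∀ x, meanHomotopy μ ν (n + 1)
        (realDifferential X (n + 1) (fixFirst (n + 1) x f)) (Fin.tail y) =
        iteratedMean ν (n + 1) (fixFirst (n + 1) x f) (Fin.tail y) -
          iteratedMean μ (n + 1) (fixFirst (n + 1) x f) (Fin.tail y) -
          realDifferential Y n (meanHomotopy μ ν n (fixFirst (n + 1) x f)) (Fin.tail y) := by
      intro x
      rw [← realDifferential_meanHomotopy hμ hν n (fixFirst (n + 1) x f) (Fin.tail y)]
      ring
    rw [h1, realDifferential_functional]
    simp only [h2, h3, functional_sub]
    have h4 : ∀ x, (realDifferential Y n fun ys =>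
        iteratedMean ν (n + 1) (fixFirst (n + 1) x f) (Fin.cons (y 0) ys) -
          meanHomotopy μ ν n (fixFirst (n + 1) x f) ys) (Fin.tail y) =
        realDifferential Y n
            (fixFirst n (y 0) (iteratedMean ν (n + 1) (fixFirst (n + 1) x f))) (Fin.tail y) -
          realDifferential Y n (meanHomotopy μ ν n (fixFirst (n + 1) x f)) (Fin.tail y) := by
      intro x
      rw [← Pi.sub_apply, ← map_sub]
      rfl
    simp only [h4, functional_sub]
    rw [iteratedMean_succ μ]
    ring

/-- The iterated mean of Dirac functionals along a map is the pullback. -/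
theorem iteratedMean_comp_proj (μ : Y → (X → ℝ) →ₗ[ℝ] ℝ) (p : Z → Y) :
    ∀ (n : ℕ) (f : (Fin n → X) → ℝ) (z : Fin n → Z),
      iteratedMean (fun z => μ (p z)) n f z = iteratedMean μ n f fun i => p (z i)
  | 0, _, _ => rfl
  | n + 1, f, z => by
    simp only [iteratedMean_succ, iteratedMean_comp_proj μ p n]
    rfl

/-- Change of variables: integrating against the pushforward kernel is pulling back first and
integrating afterwards. -/
theorem iteratedMean_comp_funLeft (μ : Y → (X → ℝ) →ₗ[ℝ] ℝ) (p : X → Z) :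
    ∀ (n : ℕ) (f : (Fin n → Z) → ℝ) (y : Fin n → Y),
      iteratedMean (fun y => μ y ∘ₗ LinearMap.funLeft ℝ ℝ p) n f y =
        iteratedMean μ n (fun x => f fun i => p (x i)) y
  | 0, f, y => congrArg f (Subsingleton.elim _ _)
  | n + 1, f, y => by
    simp only [iteratedMean_succ, iteratedMean_comp_funLeft μ p n, LinearMap.comp_apply]
    refine congrArg (μ (y 0)) (funext fun x => ?_)
    rw [LinearMap.funLeft_apply]
    refine congrArg (fun F => iteratedMean μ n F (Fin.tail y)) (funext fun xs => ?_)
    rw [fixFirst_apply, fixFirst_apply]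
    congr 1
    funext i
    refine Fin.cases rfl (fun j => rfl) i

theorem iteratedMean_proj :
    ∀ (n : ℕ) (f : (Fin n → X) → ℝ) (x : Fin n → X),
      iteratedMean (fun x : X => LinearMap.proj x) n f x = f x
  | 0, f, x => congrArg f (Subsingleton.elim _ _)
  | n + 1, f, x => by
    simp only [iteratedMean_succ, iteratedMean_proj n, LinearMap.proj_apply]
    rw [fixFirst_apply, Fin.cons_self_tail]

end IteratedMeans

/-! ### Equivariance and boundedness of iterated means -/

section Equivariance

variable {G : Type u} [Group G] {X : Type*} {Y : Type*} [MulAction G X] [MulAction G Y]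

/-- A `G`-equivariant family of means on `X` indexed by `Y`, as functionals on all functions on `X`;
nothing is required of their values on unbounded functions beyond linearity. -/
structure IsMeanKernel (G : Type u) [Group G] [MulAction G X] [MulAction G Y]
    (μ : Y → (X → ℝ) →ₗ[ℝ] ℝ) : Prop where
  map_one : ∀ y, μ y 1 = 1
  abs_le : ∀ y (f : X → ℝ) (C : ℝ), (∀ x, |f x| ≤ C) → |μ y f| ≤ C
  equivariant : ∀ (g : G) y (f : X → ℝ) (C : ℝ), (∀ x, |f x| ≤ C) →
    μ (g • y) f = μ y fun x => f (g • x)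

/-- An operator from functions on `A` to functions on `B` that is bounded with respect to the
supremum norms and commutes with `G` on bounded functions. -/
structure IsBoundedEquivariant (G : Type u) [Group G] {A B : Type*} [MulAction G A] [MulAction G B]
    (T : (A → ℝ) →ₗ[ℝ] (B → ℝ)) (K : ℝ) : Prop where
  abs_le : ∀ (f : A → ℝ) (C : ℝ), (∀ x, |f x| ≤ C) → ∀ y, |T f y| ≤ K * C
  equivariant : ∀ (g : G) (f : A → ℝ) (C : ℝ), (∀ x, |f x| ≤ C) →
    ∀ y, T f (g • y) = T (fun x => f (g • x)) y

theorem fixFirst_smul (n : ℕ) (f : (Fin (n + 1) → X) → ℝ) (g : G) (x : X) :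
    (fun xs => fixFirst n (g • x) f (g • xs)) = fixFirst n x fun xs => f (g • xs) := by
  funext xs
  rw [fixFirst_apply, fixFirst_apply]
  congr 1
  funext i
  exact Fin.cases rfl (fun _ => rfl) i

/-- Each inner integral of a bounded function is bounded by the same constant, so the kernel axioms,
which concern bounded functions only, apply at every stage. -/
theorem IsMeanKernel.isBoundedEquivariant_iteratedMean {μ : Y → (X → ℝ) →ₗ[ℝ] ℝ}
    (hμ : IsMeanKernel G μ) : ∀ n : ℕ, IsBoundedEquivariant G (iteratedMean μ n) 1
  | 0 => ⟨fun f C hf _ => by rw [one_mul]; exact hf _,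
      fun g f _ _ _ => congrArg f (Subsingleton.elim _ _)⟩
  | n + 1 => by
    have ih := hμ.isBoundedEquivariant_iteratedMean n
    refine ⟨fun f C hf y => ?_, fun g f C hf y => ?_⟩
    · rw [iteratedMean_succ, one_mul]
      refine hμ.abs_le _ _ _ fun x => ?_
      simpa only [one_mul] using ih.abs_le (fixFirst n x f) C (fun xs => hf _) _
    · rw [iteratedMean_succ, iteratedMean_succ, Pi.smul_apply,
        hμ.equivariant g (y 0) _ (1 * C) fun x => ih.abs_le (fixFirst n x f) C (fun xs => hf _) _]
      congr 1
      funext x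
      rw [← fixFirst_smul, ← ih.equivariant g (fixFirst n (g • x) f) C fun xs => hf _]
      rfl

/-- The constant `n` counts the terms of the prism operator, each of which is an iterated mean of
norm at most one. -/
theorem IsMeanKernel.isBoundedEquivariant_meanHomotopy {μ ν : Y → (X → ℝ) →ₗ[ℝ] ℝ}
    (hμ : IsMeanKernel G μ) (hν : IsMeanKernel G ν) :
    ∀ n : ℕ, IsBoundedEquivariant G (meanHomotopy μ ν n) n
  | 0 => ⟨fun f C hf y => by simp [meanHomotopy], fun _ _ _ _ _ => rfl⟩
  | n + 1 => by
    have ih := hμ.isBoundedEquivariant_meanHomotopy hν n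
    have hi := hν.isBoundedEquivariant_iteratedMean (n + 1)
    have key : ∀ (f : (Fin (n + 2) → X) → ℝ) (C : ℝ), (∀ x, |f x| ≤ C) → ∀ y ys x,
        |iteratedMean ν (n + 1) (fixFirst (n + 1) x f) y -
          meanHomotopy μ ν n (fixFirst (n + 1) x f) ys| ≤ ((n + 1 : ℕ) : ℝ) * C := by
      intro f C hf y ys x
      have h1 := hi.abs_le (fixFirst (n + 1) x f) C (fun xs => hf _) y
      have h2 := ih.abs_le (fixFirst (n + 1) x f) C (fun xs => hf _) ys
      refine (abs_sub _ _).trans ?_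
      push_cast
      linarith
    refine ⟨fun f C hf y => ?_, fun g f C hf y => ?_⟩
    · rw [meanHomotopy_succ]
      exact hμ.abs_le _ _ _ fun x => key f C hf _ _ x
    · rw [meanHomotopy_succ, meanHomotopy_succ, Pi.smul_apply,
        hμ.equivariant g (y 0) _ _ fun x => key f C hf _ _ x]
      congr 1
      funext x
      rw [← fixFirst_smul, ← ih.equivariant g (fixFirst (n + 1) (g • x) f) C fun xs => hf _,
        ← hi.equivariant g (fixFirst (n + 1) (g • x) f) C fun xs => hf _]
      rfl

end Equivariance

/-! ### Cochains with values in a dual module -/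

section DualCochains

variable {G : Type u} [Group G] {V : Type v} [NormedAddCommGroup V] [NormedSpace ℝ V]
  {X : Type w} {Y : Type w} [MulAction G X] [MulAction G Y]

theorem differential_dual_apply (n : ℕ) (f : (Fin (n + 1) → X) → StrongDual ℝ V) (v : V)
    (x : Fin (n + 2) → X) :
    differential (StrongDual ℝ V) X n f x v = realDifferential X (n + 1) (fun x => f x v) x := by
  simp [differential, realDifferential]

theorem exists_abs_apply_le {ρ : NormedRep G (StrongDual ℝ V)} {n : ℕ}
    {f : (Fin (n + 1) → X) → StrongDual ℝ V} (hf : f ∈ cochains ρ X n) :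
    ∃ C : ℝ, ∀ x v, |f x v| ≤ C * ‖v‖ := by
  obtain ⟨⟨C, hC⟩, -⟩ := hf
  exact ⟨C, fun x v => ((f x).le_opNorm v).trans
    (mul_le_mul_of_nonneg_right (hC x) (norm_nonneg v))⟩

/-- A bounded equivariant operator on real functions extends to cochains with values in a dual
module. -/
theorem IsBoundedEquivariant.exists_cochain (ρ : NormedRep G V) {n m : ℕ}
    {T : ((Fin (n + 1) → X) → ℝ) →ₗ[ℝ] ((Fin (m + 1) → Y) → ℝ)} {K : ℝ} (hK : 0 ≤ K)
    (hT : IsBoundedEquivariant G T K) {f : (Fin (n + 1) → X) → StrongDual ℝ V}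
    (hf : f ∈ cochains (dualRep ρ) X n) :
    ∃ f' ∈ cochains (dualRep ρ) Y m, ∀ y v, f' y v = T (fun x => f x v) y := by
  obtain ⟨C, hC⟩ := exists_abs_apply_le hf
  -- Nothing makes `C` non-negative when `X` is empty, whereas the operator norm bound below needs a
  -- non-negative constant.
  have hb : ∀ y v, |T (fun x => f x v) y| ≤ K * max C 0 * ‖v‖ := fun y v => by
    refine (hT.abs_le _ _ (fun x => hC x v) y).trans ?_
    rw [mul_assoc]
    gcongr
    exact le_max_left _ _
  refine ⟨fun y => LinearMap.mkContinuous
    { toFun := fun v => T (fun x => f x v) y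
      map_add' := fun v w => by
        rw [← Pi.add_apply, ← map_add]
        exact congrArg (fun F => T F y) (funext fun x => map_add (f x) v w)
      map_smul' := fun c v => by
        rw [RingHom.id_apply, ← Pi.smul_apply, ← map_smul]
        exact congrArg (fun F => T F y) (funext fun x => map_smul (f x) c v) } (K * max C 0) (hb y), ⟨⟨K * max C 0, fun y => ?_⟩, ?_⟩,
    fun y v => rfl⟩
  · exact LinearMap.mkContinuous_norm_le _ (by positivity) _
  · intro g y
    ext v
    change T (fun x => f x v) (g • y) = T (fun x => f x (ρ g⁻¹ v)) y
    rw [hT.equivariant g _ _ fun x => hC x v]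
    refine congrArg (fun F => T F y) (funext fun x => ?_)
    rw [hf.2 g x]
    rfl

/-- On a cocycle one term of the homotopy formula vanishes, leaving the difference as the
differential of the prism operator. That operator is bounded and equivariant, so it produces an
honest cochain. In degree 0 it is zero and the two transfers agree. -/
theorem IsMeanKernel.sub_mem_coboundaries (ρ : NormedRep G V) {μ ν : Y → (X → ℝ) →ₗ[ℝ] ℝ}
    (hμ : IsMeanKernel G μ) (hν : IsMeanKernel G ν) (n : ℕ)
    {f : (Fin (n + 1) → X) → StrongDual ℝ V} (hf : f ∈ cocycles (dualRep ρ) X n)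
    {a b : (Fin (n + 1) → Y) → StrongDual ℝ V}
    (ha : ∀ y v, a y v = iteratedMean μ (n + 1) (fun x => f x v) y)
    (hb : ∀ y v, b y v = iteratedMean ν (n + 1) (fun x => f x v) y) :
    b - a ∈ coboundaries (dualRep ρ) Y n := by
  have hdf : ∀ v, realDifferential X (n + 1) (fun x => f x v) = 0 := by
    intro v
    funext x
    rw [← differential_dual_apply]
    have h : differential (StrongDual ℝ V) X n f = 0 := hf.2
    rw [h]
    rfl
  have key : ∀ y v, (b - a) y v =
      realDifferential Y n (meanHomotopy μ ν n fun x => f x v) y := by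
    intro y v
    have h := realDifferential_meanHomotopy hμ.map_one hν.map_one n (fun x => f x v) y
    rw [hdf, map_zero, Pi.zero_apply, add_zero, ← ha, ← hb] at h
    exact h.symm
  cases n with
  | zero =>
    change b - a = 0
    ext y v
    rw [key]
    have h0 : meanHomotopy μ ν 0 = 0 := rfl
    simp [h0]
  | succ k =>
    obtain ⟨c, hc, hcv⟩ := (hμ.isBoundedEquivariant_meanHomotopy hν (k + 1)).exists_cochain ρ
      (Nat.cast_nonneg _) hf.1
    refine ⟨c, hc, ?_⟩
    ext y v
    rw [key, differential_dual_apply]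
    simp only [hcv]

theorem isMeanKernel_proj : IsMeanKernel G (fun x : X => (LinearMap.proj x : (X → ℝ) →ₗ[ℝ] ℝ)) :=
  ⟨fun _ => rfl, fun y _ _ h => h y, fun _ _ _ _ _ => rfl⟩

theorem IsMeanKernel.comp_map {μ : Y → (X → ℝ) →ₗ[ℝ] ℝ} (hμ : IsMeanKernel G μ) (p : X →[G] Y) :
    IsMeanKernel G (fun x => μ (p x)) :=
  ⟨fun _ => hμ.map_one _, fun _ => hμ.abs_le _, fun g x f C hf => by
    rw [map_smul]; exact hμ.equivariant g _ f C hf⟩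

theorem IsMeanKernel.comp_funLeft {μ : Y → (X → ℝ) →ₗ[ℝ] ℝ} (hμ : IsMeanKernel G μ)
    (p : X →[G] Y) : IsMeanKernel G (fun y => μ y ∘ₗ LinearMap.funLeft ℝ ℝ p) :=
  ⟨fun _ => hμ.map_one _, fun y f C hf => hμ.abs_le y _ C fun _ => hf _, fun g y f C hf => by
    change μ (g • y) (fun x => f (p x)) = μ y fun x => f (g • p x)
    rw [hμ.equivariant g y _ C fun _ => hf _]
    simp only [map_smul]⟩

/-- The transfer of a cocycle along a kernel of means. -/
theorem IsMeanKernel.exists_cocycle (ρ : NormedRep G V) {μ : Y → (X → ℝ) →ₗ[ℝ] ℝ}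
    (hμ : IsMeanKernel G μ) {n : ℕ} {f : (Fin (n + 1) → X) → StrongDual ℝ V}
    (hf : f ∈ cocycles (dualRep ρ) X n) :
    ∃ f' ∈ cocycles (dualRep ρ) Y n, ∀ y v, f' y v = iteratedMean μ (n + 1) (fun x => f x v) y := by
  obtain ⟨f', hf', h⟩ :=
    (hμ.isBoundedEquivariant_iteratedMean (n + 1)).exists_cochain ρ zero_le_one hf.1
  refine ⟨f', ⟨hf', LinearMap.mem_ker.2 ?_⟩, h⟩
  ext y v
  rw [differential_dual_apply]
  simp only [h]
  rw [realDifferential_iteratedMean hμ.map_one]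
  have h0 : realDifferential X (n + 1) (fun x => f x v) = 0 := by
    funext x
    rw [← differential_dual_apply, show differential (StrongDual ℝ V) X n f = 0 from hf.2]
    rfl
  rw [h0, map_zero]
  rfl

theorem IsMeanKernel.exists_coboundary (ρ : NormedRep G V) {μ : Y → (X → ℝ) →ₗ[ℝ] ℝ}
    (hμ : IsMeanKernel G μ) {n : ℕ} {f : (Fin (n + 1) → X) → StrongDual ℝ V}
    (hf : f ∈ coboundaries (dualRep ρ) X n) :
    ∃ f' ∈ coboundaries (dualRep ρ) Y n,
      ∀ y v, f' y v = iteratedMean μ (n + 1) (fun x => f x v) y := by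
  cases n with
  | zero =>
    have h : f = 0 := hf
    refine ⟨0, Submodule.zero_mem _, fun y v => ?_⟩
    have h0 : (fun x => f x v) = 0 := by rw [h]; rfl
    rw [h0, map_zero]
    rfl
  | succ k =>
    obtain ⟨b, hb, rfl⟩ := hf
    obtain ⟨b', hb', h⟩ :=
      (hμ.isBoundedEquivariant_iteratedMean (k + 1)).exists_cochain ρ zero_le_one hb
    refine ⟨_, ⟨b', hb', rfl⟩, fun y v => ?_⟩
    rw [differential_dual_apply]
    simp only [h]
    rw [realDifferential_iteratedMean hμ.map_one]
    refine congrArg (fun F => iteratedMean μ (k + 2) F y) (funext fun x => ?_)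
    rw [differential_dual_apply]

theorem cohomologyMap_class (ρ : NormedRep G V) (p : X →[G] Y) (n : ℕ) (c : cocycles ρ Y n) :
    cohomologyMap ρ p n (cohomologyClass ρ Y n c) =
      cohomologyClass ρ X n ⟨pullback V p n c, pullback_mem_cocycles ρ p n c c.2⟩ := rfl

theorem cohomologyClass_eq_zero_iff (ρ : NormedRep G V) (n : ℕ) (c : cocycles ρ X n) :
    cohomologyClass ρ X n c = 0 ↔ (c : (Fin (n + 1) → X) → V) ∈ coboundaries ρ X n := by
  rw [← map_zero (cohomologyClass ρ X n), cohomologyClass_eq_iff]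
  simp

/-- An equivariant family of means on `X` indexed by `Y` inverts a `G`-map `X → Y` on bounded
cohomology with dual coefficients. -/
theorem IsMeanKernel.bijective_cohomologyMap (ρ : NormedRep G V) {μ : Y → (X → ℝ) →ₗ[ℝ] ℝ}
    (hμ : IsMeanKernel G μ) (p : X →[G] Y) (n : ℕ) :
    Function.Bijective (cohomologyMap (dualRep ρ) p n) := by
  constructor
  · rw [← LinearMap.ker_eq_bot, LinearMap.ker_eq_bot']
    intro c hc
    obtain ⟨⟨f, hf⟩, rfl⟩ := cohomologyClass_surjective _ _ _ c
    rw [cohomologyMap_class, cohomologyClass_eq_zero_iff] at hc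
    rw [cohomologyClass_eq_zero_iff]
    obtain ⟨a, ha, hav⟩ := hμ.exists_coboundary ρ hc
    -- Restricting `f` and then integrating is integration against the pushed-forward kernel on `Y`,
    -- which is compared with the Dirac kernel.
    have h := (hμ.comp_funLeft p).sub_mem_coboundaries ρ isMeanKernel_proj n hf
      (a := a) (b := f) (fun y v => by rw [hav, iteratedMean_comp_funLeft]; rfl)
      (fun y v => by rw [iteratedMean_proj])
    simpa using Submodule.add_mem _ h ha
  · intro c
    obtain ⟨⟨f, hf⟩, rfl⟩ := cohomologyClass_surjective _ _ _ c
    obtain ⟨a, ha, hav⟩ := hμ.exists_cocycle ρ hf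
    refine ⟨cohomologyClass _ _ _ ⟨a, ha⟩, ?_⟩
    rw [cohomologyMap_class, cohomologyClass_eq_iff]
    -- Integrating and then restricting is integration against the kernel reindexed along `p`, again
    -- compared with the Dirac kernel.
    refine isMeanKernel_proj.sub_mem_coboundaries ρ (hμ.comp_map p) n hf
      (fun y v => by rw [iteratedMean_proj]) fun y v => ?_
    rw [iteratedMean_comp_proj, ← hav]
    rfl

end DualCochains

/-! ### Maps between `G`-sets -/

section GSets

variable {G : Type u} [Group G]

/-- If every point stabilizer of `S` fixes a point of `T`, there is an equivariant map `S → T`. -/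
theorem exists_mulActionHom {S : Type*} {T : Type*} [MulAction G S] [MulAction G T]
    (h : ∀ s : S, ∃ t : T, MulAction.stabilizer G s ≤ MulAction.stabilizer G t) :
    Nonempty (S →[G] T) := by
  choose t ht using h
  let rep : S → S := fun s => (Quotient.mk (MulAction.orbitRel G S) s).out
  have hrep : ∀ s, ∃ g : G, g • rep s = s := fun s => by
    have h1 : MulAction.orbitRel G S (rep s) s := Quotient.exact (Quotient.out_eq _)
    exact MulAction.mem_orbit_iff.1 ((MulAction.orbitRel G S).symm h1)
  have hsmul : ∀ (k : G) s, rep (k • s) = rep s := fun k s => by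
    have h1 : Quotient.mk (MulAction.orbitRel G S) (k • s) = Quotient.mk _ s :=
      Quotient.sound (s := MulAction.orbitRel G S) (MulAction.mem_orbit s k)
    simp only [rep, h1]
  choose γ hγ using hrep
  refine ⟨⟨fun s => γ s • t (rep s), fun k s => ?_⟩⟩
  rw [hsmul]
  -- Both `k * γ s` and `γ (k • s)` carry the orbit representative to `k • s`, so they differ by an
  -- element that also fixes the chosen point of `T`.
  have h1 : (k * γ s)⁻¹ * γ (k • s) ∈ MulAction.stabilizer G (rep s) := by
    rw [MulAction.mem_stabilizer_iff, mul_smul, inv_smul_eq_iff, mul_smul, hγ s]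
    conv_lhs => rw [← hsmul k s, hγ]
  have h2 := ht _ h1
  rw [MulAction.mem_stabilizer_iff, mul_smul, inv_smul_eq_iff, mul_smul] at h2
  exact h2

theorem stabilizer_cosets_mk {F : Set (Subgroup G)} (L : F) :
    MulAction.stabilizer G (⟨L, ((1 : G) : G ⧸ (L : Subgroup G))⟩ : Cosets F) = L := by
  ext g
  rw [MulAction.mem_stabilizer_iff]
  change (⟨L, g • ((1 : G) : G ⧸ (L : Subgroup G))⟩ : Cosets F) = ⟨L, _⟩ ↔ _
  rw [Sigma.mk.injEq]
  simp only [heq_eq_eq, true_and]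
  rw [← MulAction.mem_stabilizer_iff, MulAction.stabilizer_quotient]

theorem IsFamily.stabilizer_mem {F : Set (Subgroup G)} (hF : IsFamily F) (x : Cosets F) :
    MulAction.stabilizer G x ∈ F := by
  obtain ⟨L, q⟩ := x
  obtain ⟨g, rfl⟩ := QuotientGroup.mk_surjective q
  have h : (⟨L, (g : G ⧸ (L : Subgroup G))⟩ : Cosets F) =
      g • (⟨L, ((1 : G) : G ⧸ (L : Subgroup G))⟩ : Cosets F) := by
    change _ = (⟨L, g • ((1 : G) : G ⧸ (L : Subgroup G))⟩ : Cosets F)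
    rw [MulAction.Quotient.smul_coe, smul_eq_mul, mul_one]
  rw [h, MulAction.stabilizer_smul_eq_stabilizer_map_conj, stabilizer_cosets_mk]
  exact hF.conj_mem _ L.2 g

theorem stabilizer_subgroup {S : Type*} [MulAction G S] (H : Subgroup G) (s : S) :
    MulAction.stabilizer H s = (MulAction.stabilizer G s).subgroupOf H := rfl

/-- For h in H, conjugating L ∩ H gives hLh⁻¹ ∩ H; and a subgroup K of L ∩ H already lies in F, with
K = K ∩ H. -/
theorem IsFamily.restrict {F : Set (Subgroup G)} (hF : IsFamily F) (H : Subgroup G) :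
    IsFamily (restrict F H) := by
  refine ⟨?_, ?_, ?_⟩
  · obtain ⟨L, hL⟩ := hF.nonempty
    exact ⟨_, L, hL, rfl⟩
  · rintro _ ⟨L, hL, rfl⟩ h
    refine ⟨_, hF.conj_mem L hL h, ?_⟩
    ext k
    simp only [Subgroup.mem_subgroupOf, Subgroup.mem_map]
    constructor
    · rintro ⟨x, hx, rfl⟩
      exact ⟨x, hx, rfl⟩
    · rintro ⟨x, hx, e⟩
      have hx' : x = ((h⁻¹ * k * h : H) : G) := by
        rw [Subgroup.coe_mul, Subgroup.coe_mul, ← e]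
        simp [mul_assoc]
      refine ⟨h⁻¹ * k * h, ?_, by simp [mul_assoc]⟩
      rwa [← hx']
  · rintro _ ⟨L, hL, rfl⟩ K hK
    refine ⟨K.map H.subtype, hF.mem_of_le L hL _ ?_, ?_⟩
    · rintro _ ⟨k, hk, rfl⟩
      exact hK hk
    · ext k
      simp [Subgroup.mem_subgroupOf]

end GSets

/-! ### Means -/

section Means

variable {G : Type u} [Group G] {S : Type v} {T : Type w}

/-- A function with bounded absolute value, as an element of `ℓ^∞`. -/
def LInf.ofBounded (f : S → ℝ) (C : ℝ) (h : ∀ s, |f s| ≤ C) : LInf S :=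
  ⟨f, memℓp_infty ⟨C, by rintro _ ⟨s, rfl⟩; exact h s⟩⟩

theorem LInf.abs_apply_le (f : LInf S) (s : S) : |f s| ≤ ‖f‖ :=
  lp.norm_apply_le_norm ENNReal.top_ne_zero f s

theorem LInf.one_apply (s : S) : (1 : LInf S) s = 1 := rfl

/-- The pullback of bounded functions along a map. -/
def LInf.comap (p : S → T) : LInf T →ₗ[ℝ] LInf S where
  toFun f := LInf.ofBounded (fun s => f (p s)) ‖f‖ fun _ => LInf.abs_apply_le f _
  map_add' _ _ := rfl
  map_smul' _ _ := rfl

theorem HasInvariantMean.map [MulAction G S] [MulAction G T] (p : S →[G] T)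
    (h : HasInvariantMean G S) : HasInvariantMean G T := by
  obtain ⟨m, h1, hpos, hinv⟩ := h
  refine ⟨m ∘ₗ LInf.comap p, h1, fun f hf => hpos _ fun s => hf _, fun g f => ?_⟩
  rw [LinearMap.comp_apply, LinearMap.comp_apply, ← hinv g (LInf.comap p f)]
  congr 1
  ext s
  rw [lInfRep_apply]
  change f (g⁻¹ • p s) = f (p (g⁻¹ • s))
  rw [map_smul]

/-- Amenability of `H` relative to `F|_H` in terms of the `G`-set `G/F`. -/
theorem amenableRelativeTo_restrict_iff {F : Set (Subgroup G)} (hF : IsFamily F)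
    (H : Subgroup G) :
    AmenableRelativeTo H (restrict F H) ↔ HasInvariantMean H (Cosets F) := by
  constructor
  · intro h
    -- A point stabilizer here has the form L ∩ H with L ∈ F, so it fixes the base coset of G/L.
    obtain ⟨p⟩ : Nonempty (Cosets (restrict F H) →[H] Cosets F) := by
      refine exists_mulActionHom fun s => ?_
      obtain ⟨L, hL, hs⟩ := (hF.restrict H).stabilizer_mem s
      refine ⟨⟨⟨L, hL⟩, (1 : G)⟩, ?_⟩
      rw [hs, stabilizer_subgroup, stabilizer_cosets_mk]
    exact HasInvariantMean.map p h
  · intro h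
    -- Conversely, the H-stabilizer of a point of G/F belongs to F|_H and fixes its own base coset.
    obtain ⟨p⟩ : Nonempty (Cosets F →[H] Cosets (restrict F H)) := by
      refine exists_mulActionHom fun s => ?_
      refine ⟨⟨⟨MulAction.stabilizer H s, _, hF.stabilizer_mem s, rfl⟩, (1 : H)⟩, ?_⟩
      rw [stabilizer_cosets_mk]
    exact HasInvariantMean.map p h

/-- The set of means on `S`. -/
def Mean (S : Type v) : Type v :=
  {m : LInf S →ₗ[ℝ] ℝ // m 1 = 1 ∧ ∀ f : LInf S, (∀ s, 0 ≤ f s) → 0 ≤ m f}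

instance [MulAction G S] : MulAction G (Mean S) where
  smul g m := ⟨m.1 ∘ₗ (lInfRep G S g⁻¹).toLinearEquiv.toLinearMap, by
    refine ⟨?_, fun f hf => m.2.2 _ fun s => hf _⟩
    change m.1 (lInfRep G S g⁻¹ 1) = 1
    rw [lInfRep_one, m.2.1]⟩
  one_smul m := Subtype.ext <| LinearMap.ext fun f => by
    change m.1 (lInfRep G S 1⁻¹ f) = m.1 f
    rw [inv_one, map_one]
    rfl
  mul_smul g h m := Subtype.ext <| LinearMap.ext fun f => by
    change m.1 (lInfRep G S (g * h)⁻¹ f) = m.1 (lInfRep G S h⁻¹ (lInfRep G S g⁻¹ f))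
    rw [mul_inv_rev, map_mul]
    rfl

theorem Mean.smul_apply [MulAction G S] (g : G) (m : Mean S) (f : LInf S) :
    (g • m).1 f = m.1 (lInfRep G S g⁻¹ f) := rfl

/-- Positivity on C - f and C + f, together with normalization. -/
theorem Mean.abs_apply_le (m : Mean S) (f : LInf S) (C : ℝ) (h : ∀ s, |f s| ≤ C) :
    |m.1 f| ≤ C := by
  have h1 := m.2.2 (C • 1 - f) fun s => by
    have := (abs_le.1 (h s)).2
    simp only [lp.coeFn_sub, lp.coeFn_smul, Pi.sub_apply, Pi.smul_apply, LInf.one_apply,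
      smul_eq_mul]
    linarith
  have h2 := m.2.2 (C • 1 + f) fun s => by
    have := (abs_le.1 (h s)).1
    simp only [lp.coeFn_add, lp.coeFn_smul, Pi.add_apply, Pi.smul_apply, LInf.one_apply,
      smul_eq_mul]
    linarith
  rw [map_sub, map_smul, m.2.1, smul_eq_mul, mul_one] at h1
  rw [map_add, map_smul, m.2.1, smul_eq_mul, mul_one] at h2
  exact abs_le.2 ⟨by linarith, by linarith⟩

/-- There is a linear retraction of all functions onto the bounded ones. -/
theorem exists_linearRetraction (S : Type v) :
    ∃ r : (S → ℝ) →ₗ[ℝ] LInf S, ∀ f : LInf S, r f = f := by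
  let i : LInf S →ₗ[ℝ] (S → ℝ) :=
    { toFun := fun f => f
      map_add' := fun _ _ => rfl
      map_smul' := fun _ _ => rfl }
  obtain ⟨r, hr⟩ := i.exists_leftInverse_of_injective
    (LinearMap.ker_eq_bot.2 fun f g h => by ext s; exact congrFun h s)
  exact ⟨r, fun f => LinearMap.congr_fun hr f⟩

/-- The retraction `r` extends means to all functions so that iterated integrals need no boundedness
side conditions. It is not equivariant, but on bounded functions it is the identity, which is all
that the axioms test. -/
theorem isMeanKernel_of_equivariant {Y : Type*} [MulAction G S] [MulAction G Y]
    (p : Y →[G] Mean S) {r : (S → ℝ) →ₗ[ℝ] LInf S} (hr : ∀ f : LInf S, r f = f) :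
    IsMeanKernel G fun y => (p y).1 ∘ₗ r := by
  refine ⟨fun y => ?_, fun y f C hf => ?_, fun g y f C hf => ?_⟩
  · have h : r 1 = 1 := hr 1
    rw [LinearMap.comp_apply, h, (p y).2.1]
  · have h : r f = LInf.ofBounded f C hf := hr (LInf.ofBounded f C hf)
    rw [LinearMap.comp_apply, h]
    exact Mean.abs_apply_le _ _ _ hf
  · have h : r f = LInf.ofBounded f C hf := hr (LInf.ofBounded f C hf)
    have h' : (r fun x => f (g • x)) = LInf.ofBounded (fun x => f (g • x)) C fun _ => hf _ :=
      hr (LInf.ofBounded (fun x => f (g • x)) C fun _ => hf _)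
    rw [LinearMap.comp_apply, LinearMap.comp_apply, h, h', map_smul, Mean.smul_apply]
    congr 1
    ext s
    rw [lInfRep_apply, inv_inv]
    rfl

theorem exists_isMeanKernel {F E : Set (Subgroup G)} (hE : IsFamily E)
    (h : ∀ H ∈ E, HasInvariantMean H (Cosets F)) :
    ∃ μ : Cosets E → (Cosets F → ℝ) →ₗ[ℝ] ℝ, IsMeanKernel G μ := by
  obtain ⟨p⟩ : Nonempty (Cosets E →[G] Mean (Cosets F)) := by
    refine exists_mulActionHom fun y => ?_
    obtain ⟨m, h1, hpos, hinv⟩ := h _ (hE.stabilizer_mem y)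
    refine ⟨⟨m, h1, hpos⟩, fun g hg => ?_⟩
    exact Subtype.ext <| LinearMap.ext fun f => hinv (⟨g, hg⟩⁻¹ : MulAction.stabilizer G y) f
  obtain ⟨r, hr⟩ := exists_linearRetraction (Cosets F)
  exact ⟨_, isMeanKernel_of_equivariant p hr⟩

end Means

/-! ### The positive part of a bounded functional -/

section PositivePart

variable {G : Type u} [Group G] {S : Type v}

/-- The values of a functional on the functions between zero and `f`. -/
def valuesBelow (ψ : LInf S →ₗ[ℝ] ℝ) (f : LInf S) : Set ℝ :=
  {r | ∃ g : LInf S, (∀ s, 0 ≤ g s) ∧ (∀ s, g s ≤ f s) ∧ ψ g = r}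

/-- The positive part of a functional, on non-negative functions. -/
def posPart (ψ : LInf S →ₗ[ℝ] ℝ) (f : LInf S) : ℝ := sSup (valuesBelow ψ f)

variable {ψ : LInf S →ₗ[ℝ] ℝ} {C : ℝ}

theorem bddAbove_valuesBelow (hC : ∀ f, |ψ f| ≤ C * ‖f‖) (f : LInf S) :
    BddAbove (valuesBelow ψ f) := by
  refine ⟨|C| * ‖f‖, ?_⟩
  rintro _ ⟨g, hg0, hgf, rfl⟩
  refine (le_abs_self _).trans ((hC g).trans ?_)
  refine mul_le_mul (le_abs_self C) ?_ (norm_nonneg _) (abs_nonneg _)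
  refine lp.norm_le_of_forall_le (norm_nonneg _) fun s => ?_
  rw [Real.norm_eq_abs, abs_of_nonneg (hg0 s)]
  exact (hgf s).trans ((le_abs_self _).trans (LInf.abs_apply_le f s))

theorem le_posPart (hC : ∀ f, |ψ f| ≤ C * ‖f‖) {f g : LInf S} (hg : ∀ s, 0 ≤ g s)
    (hgf : ∀ s, g s ≤ f s) : ψ g ≤ posPart ψ f :=
  le_csSup (bddAbove_valuesBelow hC f) ⟨g, hg, hgf, rfl⟩

theorem posPart_le {f : LInf S} (hf : ∀ s, 0 ≤ f s) {c : ℝ}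
    (h : ∀ g : LInf S, (∀ s, 0 ≤ g s) → (∀ s, g s ≤ f s) → ψ g ≤ c) : posPart ψ f ≤ c := by
  refine csSup_le ⟨_, f, hf, fun s => le_rfl, rfl⟩ ?_
  rintro _ ⟨g, hg, hgf, rfl⟩
  exact h g hg hgf

theorem posPart_nonneg (hC : ∀ f, |ψ f| ≤ C * ‖f‖) {f : LInf S} (hf : ∀ s, 0 ≤ f s) :
    0 ≤ posPart ψ f := by
  rw [← map_zero ψ]
  exact le_posPart hC (fun _ => le_rfl) hf

/-- Riesz decomposition: any g between 0 and f₁ + f₂ is min(g, f₁) plus a remainder between 0 and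
f₂. -/
theorem posPart_add (hC : ∀ f, |ψ f| ≤ C * ‖f‖) {f₁ f₂ : LInf S} (h₁ : ∀ s, 0 ≤ f₁ s)
    (h₂ : ∀ s, 0 ≤ f₂ s) : posPart ψ (f₁ + f₂) = posPart ψ f₁ + posPart ψ f₂ := by
  refine le_antisymm ?_ ?_
  · refine posPart_le (fun s => add_nonneg (h₁ s) (h₂ s)) fun g hg hgf => ?_
    let g₁ : LInf S := LInf.ofBounded (fun s => min (g s) (f₁ s)) ‖f₁‖ fun s => by
      rw [abs_of_nonneg (le_min (hg s) (h₁ s))]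
      exact (min_le_right _ _).trans ((le_abs_self _).trans (LInf.abs_apply_le f₁ s))
    have e : g = g₁ + (g - g₁) := by abel
    rw [e, map_add]
    refine add_le_add (le_posPart hC (fun s => le_min (hg s) (h₁ s)) fun s => min_le_right _ _)
      (le_posPart hC (fun s => sub_nonneg.2 (min_le_left _ _)) fun s => ?_)
    change g s - min (g s) (f₁ s) ≤ f₂ s
    have h : g s ≤ f₁ s + f₂ s := hgf s
    rcases min_cases (g s) (f₁ s) with h' | h' <;> linarith [h₂ s]
  · have key : ∀ g₁ : LInf S, (∀ s, 0 ≤ g₁ s) → (∀ s, g₁ s ≤ f₁ s) →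
        ψ g₁ ≤ posPart ψ (f₁ + f₂) - posPart ψ f₂ := fun g₁ hg₁ hgf₁ => by
      rw [le_sub_comm]
      refine posPart_le h₂ fun g₂ hg₂ hgf₂ => ?_
      rw [le_sub_iff_add_le', ← map_add]
      exact le_posPart hC (fun s => add_nonneg (hg₁ s) (hg₂ s))
        fun s => add_le_add (hgf₁ s) (hgf₂ s)
    exact le_sub_iff_add_le.1 (posPart_le h₁ key)

theorem posPart_smul (hC : ∀ f, |ψ f| ≤ C * ‖f‖) {f : LInf S} (hf : ∀ s, 0 ≤ f s) {r : ℝ}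
    (hr : 0 ≤ r) : posPart ψ (r • f) = r * posPart ψ f := by
  have key : ∀ (r : ℝ) (f : LInf S), 0 < r → (∀ s, 0 ≤ f s) →
      posPart ψ (r • f) ≤ r * posPart ψ f := fun r f hr hf => by
    refine posPart_le (fun s => mul_nonneg hr.le (hf s)) fun g hg hgf => ?_
    rw [← inv_mul_le_iff₀ hr, ← smul_eq_mul, ← map_smul]
    refine le_posPart hC (fun s => mul_nonneg (inv_pos.2 hr).le (hg s)) fun s => ?_
    exact (inv_mul_le_iff₀ hr).2 (hgf s)
  rcases hr.eq_or_lt with rfl | hr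
  · rw [zero_smul, zero_mul]
    -- Additivity at 0 + 0 forces the value at 0 to vanish.
    have h := posPart_add hC (f₁ := (0 : LInf S)) (f₂ := 0) (fun _ => le_rfl) fun _ => le_rfl
    rw [add_zero] at h
    linarith
  · refine le_antisymm (key r f hr hf) ?_
    have h := key r⁻¹ (r • f) (inv_pos.2 hr) fun s => mul_nonneg hr.le (hf s)
    rw [smul_smul, inv_mul_cancel₀ hr.ne', one_smul] at h
    exact (le_inv_mul_iff₀ hr).1 h

theorem exists_nonneg_sub (f : LInf S) :
    ∃ a b : LInf S, (∀ s, 0 ≤ a s) ∧ (∀ s, 0 ≤ b s) ∧ f = a - b := by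
  refine ⟨f + ‖f‖ • 1, ‖f‖ • 1, fun s => ?_, fun s => ?_, by abel⟩
  · have := (abs_le.1 (LInf.abs_apply_le f s)).1
    simp only [lp.coeFn_add, lp.coeFn_smul, Pi.add_apply, Pi.smul_apply, LInf.one_apply,
      smul_eq_mul]
    linarith
  · exact mul_nonneg (norm_nonneg _) zero_le_one

/-- The positive part extends to a linear functional. -/
theorem exists_linear_posPart (hC : ∀ f, |ψ f| ≤ C * ‖f‖) :
    ∃ m : LInf S →ₗ[ℝ] ℝ, ∀ f : LInf S, (∀ s, 0 ≤ f s) → m f = posPart ψ f := by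
  choose a b ha hb hab using exists_nonneg_sub (S := S)
  -- The value is independent of how f is written as a difference of non-negative functions, so
  -- linearity may be checked on convenient decompositions; a negative scalar swaps the two parts.
  have key : ∀ f c d : LInf S, (∀ s, 0 ≤ c s) → (∀ s, 0 ≤ d s) → f = c - d →
      posPart ψ (a f) - posPart ψ (b f) = posPart ψ c - posPart ψ d := fun f c d hc hd h => by
    have e : a f + d = c + b f := by
      rw [← sub_eq_sub_iff_add_eq_add, ← hab, h]
    have e' := congrArg (posPart ψ) e
    rw [posPart_add hC (ha f) hd, posPart_add hC hc (hb f)] at e'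
    linarith
  refine ⟨
    { toFun := fun f => posPart ψ (a f) - posPart ψ (b f)
      map_add' := fun f g => ?_
      map_smul' := fun r f => ?_ }, fun f hf => ?_⟩
  · rw [key (f + g) (a f + a g) (b f + b g) (fun s => add_nonneg (ha f s) (ha g s))
      (fun s => add_nonneg (hb f s) (hb g s)) (by
        conv_lhs => rw [hab f, hab g]
        abel),
      posPart_add hC (ha f) (ha g), posPart_add hC (hb f) (hb g)]
    ring
  · rw [RingHom.id_apply, smul_eq_mul]
    rcases le_total 0 r with hr | hr
    · rw [key (r • f) (r • a f) (r • b f) (fun s => mul_nonneg hr (ha f s))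
        (fun s => mul_nonneg hr (hb f s)) (by rw [← smul_sub, ← hab]),
        posPart_smul hC (ha f) hr, posPart_smul hC (hb f) hr]
      ring
    · have hr' : 0 ≤ -r := neg_nonneg.2 hr
      rw [key (r • f) ((-r) • b f) ((-r) • a f) (fun s => mul_nonneg hr' (hb f s))
        (fun s => mul_nonneg hr' (ha f s)) (by
          rw [← smul_sub, neg_smul, ← smul_neg, neg_sub, ← hab]),
        posPart_smul hC (ha f) hr', posPart_smul hC (hb f) hr']
      ring
  · change posPart ψ (a f) - posPart ψ (b f) = _
    rw [key f f 0 hf (fun _ => le_rfl) (sub_zero f).symm]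
    have h := posPart_smul hC (f := (0 : LInf S)) (fun _ => le_rfl) (le_refl (0 : ℝ))
    rw [smul_zero, zero_mul] at h
    rw [h, sub_zero]

variable [MulAction G S]

theorem posPart_lInfRep (hinv : ∀ (g : G) f, ψ (lInfRep G S g f) = ψ f) (g : G) (f : LInf S) :
    posPart ψ (lInfRep G S g f) = posPart ψ f := by
  have key : ∀ (g : G) f, valuesBelow ψ f ⊆ valuesBelow ψ (lInfRep G S g f) := by
    rintro g f _ ⟨k, hk, hkf, rfl⟩
    exact ⟨lInfRep G S g k, fun s => hk _, fun s => hkf _, hinv g k⟩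
  refine congrArg sSup (Set.Subset.antisymm ?_ (key g f))
  have h := key g⁻¹ (lInfRep G S g f)
  have e : lInfRep G S g⁻¹ (lInfRep G S g f) = f := by
    ext s
    rw [lInfRep_apply, lInfRep_apply, inv_inv, inv_smul_smul]
  rwa [e] at h

/-- A normalized bounded invariant functional yields an invariant mean. -/
theorem hasInvariantMean_of_functional (hC : ∀ f, |ψ f| ≤ C * ‖f‖) (h1 : ψ 1 = 1)
    (hinv : ∀ (g : G) f, ψ (lInfRep G S g f) = ψ f) : HasInvariantMean G S := by
  obtain ⟨m, hm⟩ := exists_linear_posPart hC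
  have hone : ∀ s, 0 ≤ (1 : LInf S) s := fun _ => zero_le_one
  -- The positive part dominates ψ at 1. Its mass may exceed one, so it is divided out at the end.
  have hm1 : 1 ≤ m 1 := by
    rw [hm 1 hone]
    exact h1.symm.le.trans (le_posPart hC hone fun _ => le_rfl)
  have hpos : 0 < m 1 := zero_lt_one.trans_le hm1
  have hm_inv : ∀ (g : G) f, m (lInfRep G S g f) = m f := fun g f => by
    obtain ⟨a, b, ha, hb, rfl⟩ := exists_nonneg_sub f
    rw [map_sub, map_sub, map_sub, hm (lInfRep G S g a) fun s => ha _,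
      hm (lInfRep G S g b) fun s => hb _, hm a ha, hm b hb, posPart_lInfRep hinv, posPart_lInfRep hinv]
  refine ⟨(m 1)⁻¹ • m, ?_, fun f hf => ?_, fun g f => ?_⟩
  · simp [hpos.ne']
  · rw [LinearMap.smul_apply, hm f hf]
    exact mul_nonneg (inv_nonneg.2 hpos.le) (posPart_nonneg hC hf)
  · rw [LinearMap.smul_apply, LinearMap.smul_apply, hm_inv]

end PositivePart

/-! ### Change of coefficients -/

section Coefficients

variable {G : Type u} [Group G] {X : Type w} {Y : Type w} [MulAction G X] [MulAction G Y]
  {V : Type*} [NormedAddCommGroup V] [NormedSpace ℝ V]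
  {W : Type*} [NormedAddCommGroup W] [NormedSpace ℝ W]
  {ρ : NormedRep G V} {σ : NormedRep G W} {T : V →L[ℝ] W}

theorem differential_comp (T : V →L[ℝ] W) (n : ℕ) (f : (Fin (n + 1) → X) → V) :
    differential W X n (fun x => T (f x)) = fun x => T (differential V X n f x) := by
  funext x
  simp [differential, map_sum]

theorem comp_mem_cochains (hT : ∀ g v, T (ρ g v) = σ g (T v)) {n : ℕ}
    {f : (Fin (n + 1) → X) → V} (hf : f ∈ cochains ρ X n) :
    (fun x => T (f x)) ∈ cochains σ X n := by
  obtain ⟨⟨C, hC⟩, he⟩ := hf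
  refine ⟨⟨‖T‖ * C, fun x => (T.le_opNorm _).trans ?_⟩, fun g x => by simp only [he, hT]⟩
  exact mul_le_mul_of_nonneg_left (hC x) (norm_nonneg _)

theorem comp_mem_cocycles (hT : ∀ g v, T (ρ g v) = σ g (T v)) {n : ℕ}
    {f : (Fin (n + 1) → X) → V} (hf : f ∈ cocycles ρ X n) :
    (fun x => T (f x)) ∈ cocycles σ X n := by
  refine ⟨comp_mem_cochains hT hf.1, LinearMap.mem_ker.2 ?_⟩
  rw [differential_comp, show differential V X n f = 0 from hf.2]
  funext x
  exact map_zero T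

theorem comp_mem_coboundaries (hT : ∀ g v, T (ρ g v) = σ g (T v)) {n : ℕ}
    {f : (Fin (n + 1) → X) → V} (hf : f ∈ coboundaries ρ X n) :
    (fun x => T (f x)) ∈ coboundaries σ X n := by
  cases n with
  | zero =>
    have h : f = 0 := hf
    subst h
    have h0 : (fun x : Fin 1 → X => T ((0 : (Fin 1 → X) → V) x)) = 0 := by
      funext x
      exact map_zero T
    rw [h0]
    exact Submodule.zero_mem _
  | succ k =>
    obtain ⟨b, hb, rfl⟩ := hf
    exact ⟨fun x => T (b x), comp_mem_cochains hT hb, differential_comp T k b⟩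

/-- Surjectivity on cohomology passes to equivariant retracts of the coefficients. -/
theorem surjective_cohomologyMap_of_retract (p : X →[G] Y) (n : ℕ)
    (hT : ∀ g v, T (ρ g v) = σ g (T v)) {T' : W →L[ℝ] V} (hT' : ∀ g w, T' (σ g w) = ρ g (T' w))
    (hTT' : ∀ w, T (T' w) = w) (h : Function.Surjective (cohomologyMap ρ p n)) :
    Function.Surjective (cohomologyMap σ p n) := by
  intro c
  obtain ⟨⟨f, hf⟩, rfl⟩ := cohomologyClass_surjective _ _ _ c
  obtain ⟨d, hd⟩ := h (cohomologyClass _ _ _ ⟨_, comp_mem_cocycles hT' hf⟩)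
  obtain ⟨⟨a, ha⟩, rfl⟩ := cohomologyClass_surjective _ _ _ d
  rw [cohomologyMap_class, cohomologyClass_eq_iff] at hd
  refine ⟨cohomologyClass _ _ _ ⟨_, comp_mem_cocycles hT ha⟩, ?_⟩
  rw [cohomologyMap_class, cohomologyClass_eq_iff]
  convert comp_mem_coboundaries hT hd using 1
  funext x
  simp only [Pi.sub_apply, map_sub, hTT']
  rfl

/-- The transport of a representation to a lift of the space to a larger universe. -/
def uliftRep (ρ : NormedRep G V) : NormedRep G (ULift.{v} V) :=
  NormedRep.ofLinear
    (fun g => ULift.moduleEquiv.symm.toLinearMap ∘ₗ (ρ g).toLinearEquiv.toLinearMap ∘ₗ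
      ULift.moduleEquiv.toLinearMap)
    (fun v => by simp)
    (fun g h v => by simp)
    (fun g v => ((ρ g).norm_map v.down).le)

/-- The Johnson coefficients live in universe `u`, while condition 3 quantifies over modules in `max
u v`; the lift is isometric, so its dual retracts equivariantly onto the original dual. -/
theorem surjective_cohomologyMap_of_ulift (ρ : NormedRep G V) (p : X →[G] Y) (n : ℕ)
    (h : Function.Surjective (cohomologyMap (dualRep (uliftRep.{u, v} ρ)) p n)) :
    Function.Surjective (cohomologyMap (dualRep ρ) p n) := by
  let e : ULift.{v} V ≃ₗᵢ[ℝ] V := ⟨ULift.moduleEquiv, fun _ => rfl⟩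
  refine surjective_cohomologyMap_of_retract p n
    (T := ContinuousLinearMap.precomp ℝ e.symm.toContinuousLinearEquiv.toContinuousLinearMap)
    (T' := ContinuousLinearMap.precomp ℝ e.toContinuousLinearEquiv.toContinuousLinearMap)
    (fun g φ => rfl) (fun g φ => rfl) (fun φ => rfl) h

end Coefficients

/-! ### The Johnson class and relative amenability -/

section Johnson

variable {G : Type u} [Group G] {V : Type v} [NormedAddCommGroup V] [NormedSpace ℝ V]
  {X : Type w} [MulAction G X]

theorem differential_zero_apply (f : (Fin 1 → X) → V) (x₀ x₁ : X) :
    differential V X 0 f ![x₀, x₁] = f ![x₁] - f ![x₀] := by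
  have h0 : (fun j : Fin 1 => ![x₀, x₁] (Fin.succAbove 0 j)) = ![x₁] := by
    funext j; fin_cases j; rfl
  have h1 : (fun j : Fin 1 => ![x₀, x₁] (Fin.succAbove 1 j)) = ![x₀] := by
    funext j; fin_cases j; rfl
  change ∑ i : Fin 2, (-1 : ℝ) ^ (i : ℕ) • f (fun j => ![x₀, x₁] (i.succAbove j)) = _
  rw [Fin.sum_univ_two, h0, h1]
  simp [sub_eq_add_neg]

theorem differential_one_apply (f : (Fin 2 → X) → V) (x₀ x₁ x₂ : X) :
    differential V X 1 f ![x₀, x₁, x₂] = f ![x₁, x₂] - f ![x₀, x₂] + f ![x₀, x₁] := by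
  have h0 : (fun j : Fin 2 => ![x₀, x₁, x₂] (Fin.succAbove 0 j)) = ![x₁, x₂] := by
    funext j; fin_cases j <;> rfl
  have h1 : (fun j : Fin 2 => ![x₀, x₁, x₂] (Fin.succAbove 1 j)) = ![x₀, x₂] := by
    funext j; fin_cases j <;> rfl
  have h2 : (fun j : Fin 2 => ![x₀, x₁, x₂] (Fin.succAbove 2 j)) = ![x₀, x₁] := by
    funext j; fin_cases j <;> rfl
  change ∑ i : Fin 3, (-1 : ℝ) ^ (i : ℕ) • f (fun j => ![x₀, x₁, x₂] (i.succAbove j)) = _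
  rw [Fin.sum_univ_three, h0, h1, h2]
  simp [sub_eq_add_neg]

/-- If the Johnson class comes from the larger family, each of its members leaves a mean on `G/F`
invariant. -/
theorem hasInvariantMean_of_johnsonClass_mem_range {F E : Set (Subgroup G)} (hF : IsFamily F)
    (hFE : F ⊆ E)
    (h : johnsonClass F ∈ LinearMap.range (canonicalMap hFE (johnsonRep F) 1))
    {H : Subgroup G} (hH : H ∈ E) : HasInvariantMean H (Cosets F) := by
  obtain ⟨k, hk⟩ := h
  obtain ⟨⟨c, hc⟩, rfl⟩ := cohomologyClass_surjective _ _ _ k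
  rw [canonicalMap, cohomologyMap_class, johnsonClass, cohomologyClass_eq_iff] at hk
  obtain ⟨b, hb, hbc⟩ := hk
  obtain ⟨L, hL⟩ := hF.nonempty
  let x₀ : Cosets F := ⟨⟨L, hL⟩, (1 : G)⟩
  -- An H-fixed point of G/E, available because H ∈ E; G/F need not contain one.
  let y₀ : Cosets E := ⟨⟨H, hH⟩, (1 : G)⟩
  have hy₀ : ∀ g ∈ H, g • y₀ = y₀ := fun g hg => by
    rw [← MulAction.mem_stabilizer_iff, stabilizer_cosets_mk]
    exact hg
  let ι := cosetsIncl hFE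
  -- Evaluation at `x` is not invariant. The two corrections remove its dependence on `x` and vanish
  -- on constants.
  let ψ : Cosets F → LInf (Cosets F) → ℝ := fun x f =>
    f x - c ![y₀, ι x] (LInfModConst.mk f) + b ![x] (LInfModConst.mk f)
  have hJ : ∀ x x' f, f x' - f x = c ![ι x, ι x'] (LInfModConst.mk f) -
      (b ![x'] (LInfModConst.mk f) - b ![x] (LInfModConst.mk f)) := fun x x' f => by
    have h1 := congrFun hbc ![x, x']
    rw [differential_zero_apply] at h1
    have h2 := DFunLike.congr_fun h1 (LInfModConst.mk f)
    have e : (fun i => ι (![x, x'] i)) = ![ι x, ι x'] := by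
      funext i; fin_cases i <;> rfl
    have h3 : b ![x'] (LInfModConst.mk f) - b ![x] (LInfModConst.mk f) =
        c (fun i => ι (![x, x'] i)) (LInfModConst.mk f) - (f x' - f x) := h2
    rw [h3, e]
    ring
  -- The cocycle identity on (y₀, y, y') makes `c` the coboundary of its values based at `y₀`.
  have hcc : ∀ y y' v, c ![y, y'] v - c ![y₀, y'] v + c ![y₀, y] v = 0 := fun y y' v => by
    have h1 : differential _ (Cosets E) 1 c = 0 := hc.2
    have h2 := DFunLike.congr_fun ((differential_one_apply c y₀ y y').symm.trans
      (congrFun h1 _)) v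
    exact h2
  have hψ : ∀ x x' f, ψ x' f = ψ x f := fun x x' f => by
    have h1 := hJ x x' f
    have h2 := hcc (ι x) (ι x') (LInfModConst.mk f)
    change f x' - _ + _ = f x - _ + _
    linarith
  have hψH : ∀ g ∈ H, ∀ x f, ψ (g • x) (lInfRep G _ g f) = ψ x f := fun g hg x f => by
    have e2 : (![y₀, ι (g • x)] : Fin 2 → Cosets E) = g • ![y₀, ι x] := by
      funext i
      fin_cases i
      · exact (hy₀ g hg).symm
      · exact map_smul ι g x
    have e1 : (![g • x] : Fin 1 → Cosets F) = g • ![x] := by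
      funext i
      fin_cases i
      rfl
    have e3 : lInfModConstRep G (Cosets F) g⁻¹ (LInfModConst.mk (lInfRep G _ g f)) =
        LInfModConst.mk f := by
      rw [lInfModConstRep_mk]
      congr 1
      ext s
      rw [lInfRep_apply, lInfRep_apply, inv_inv, inv_smul_smul]
    change (lInfRep G _ g f) (g • x) - c ![y₀, ι (g • x)] _ + b ![g • x] _ = _
    rw [e1, e2, hc.1.2, hb.2, johnsonRep, dualRep_apply, dualRep_apply, e3, lInfRep_apply,
      inv_smul_smul]
  have hmk : ∀ f : LInf (Cosets F), ‖LInfModConst.mk f‖ ≤ ‖f‖ :=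
    fun f => Submodule.Quotient.norm_mk_le _ f
  let Ψ : LInf (Cosets F) →ₗ[ℝ] ℝ := (evalAt x₀).toLinearMap -
    (c ![y₀, ι x₀]).toLinearMap ∘ₗ LInfModConst.mk + (b ![x₀]).toLinearMap ∘ₗ LInfModConst.mk
  refine hasInvariantMean_of_functional (ψ := Ψ) (C := 1 + ‖c ![y₀, ι x₀]‖ + ‖b ![x₀]‖)
    (fun f => ?_) ?_ fun g f => ?_
  · have h1 := LInf.abs_apply_le f x₀
    have h2 := ((c ![y₀, ι x₀]).le_opNorm (LInfModConst.mk f)).trans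
      (mul_le_mul_of_nonneg_left (hmk f) (norm_nonneg _))
    have h3 := ((b ![x₀]).le_opNorm (LInfModConst.mk f)).trans
      (mul_le_mul_of_nonneg_left (hmk f) (norm_nonneg _))
    change |f x₀ - c ![y₀, ι x₀] (LInfModConst.mk f) + b ![x₀] (LInfModConst.mk f)| ≤ _
    refine (abs_add_le _ _).trans ?_
    have h4 := abs_sub (f x₀) (c ![y₀, ι x₀] (LInfModConst.mk f))
    rw [Real.norm_eq_abs] at h2 h3
    rw [add_mul, add_mul, one_mul]
    linarith
  · change (1 : LInf (Cosets F)) x₀ - c ![y₀, ι x₀] (LInfModConst.mk 1) +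
      b ![x₀] (LInfModConst.mk 1) = 1
    rw [LInfModConst.mk_one, map_zero, map_zero, LInf.one_apply, sub_zero, add_zero]
  · change ψ x₀ (lInfRep G _ (g : G) f) = ψ x₀ f
    -- Equivariance moves the base point to `g • x₀`, and independence of the base point moves it
    -- back.
    rw [← hψH g g.2 x₀ f]
    exact hψ _ _ _

end Johnson

end BoundedBredon

end

theorem mainTheorem1 {G : Type u} [Group G] (F E : Set (Subgroup G))
    (hF : BoundedBredon.IsFamily F) (hE : BoundedBredon.IsFamily E) (hFE : F ⊆ E) :
    List.TFAE
      [ ∀ H ∈ E, BoundedBredon.AmenableRelativeTo H (BoundedBredon.restrict F H),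
        ∀ (V : Type (max u v)) [NormedAddCommGroup V] [NormedSpace ℝ V]
          (ρ : BoundedBredon.NormedRep G V) (n : ℕ),
          Function.Bijective (BoundedBredon.canonicalMap hFE (BoundedBredon.dualRep ρ) n),
        ∀ (V : Type (max u v)) [NormedAddCommGroup V] [NormedSpace ℝ V]
          (ρ : BoundedBredon.NormedRep G V),
          Function.Bijective (BoundedBredon.canonicalMap hFE (BoundedBredon.dualRep ρ) 1),
        BoundedBredon.johnsonClass F ∈
          LinearMap.range (BoundedBredon.canonicalMap hFE (BoundedBredon.johnsonRep F) 1)] := by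
  tfae_have 1 → 2 := by
    intro h V _ _ ρ n
    obtain ⟨μ, hμ⟩ := BoundedBredon.exists_isMeanKernel hE fun H hH =>
      (BoundedBredon.amenableRelativeTo_restrict_iff hF H).1 (h H hH)
    exact hμ.bijective_cohomologyMap ρ _ n
  tfae_have 2 → 3 := fun h V _ _ ρ => h V ρ 1
  tfae_have 3 → 4 := fun h =>
    BoundedBredon.surjective_cohomologyMap_of_ulift.{u, v} _ _ 1 (h _ _).2 _
  tfae_have 4 → 1 := fun h H hH =>
    (BoundedBredon.amenableRelativeTo_restrict_iff hF H).2
      (BoundedBredon.hasInvariantMean_of_johnsonClass_mem_range hF hFE h hH)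
  tfae_finish
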